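/- Let $k\ge 1$ be an integer and $\beta>0$, both fixed. A $k$-out mapping on $[n]$ is a map $M:[n]\to[n]^k$, viewed as a directed multigraph (loops and multiple arcs allowed) in which every vertex has $k$ out-arcs labelled $1,\dots,k$; let $D_j(M)$ be the in-degree of $j$, counted with multiplicity, and let $X(M):=\sum_{j=1}^n D_j(M)^2$. For $\alpha\in(0,\infty)$ let $M_{n,k}^{\alpha}$ be the random $k$-out mapping obtained from the empty digraph on $[n]$ in $kn$ steps: at each step, choose uniformly at random a vertex with current out-degree below $k$, and insert an arc from it to a vertex selected with probability proportional to its current weight, the weight of a vertex being $\alpha$ plus its current in-degree; the out-arcs of each vertex are labelled $1,\dots,k$ chronologically. Let $M_{n,k}^{\infty}$ be uniformly distributed over all $k$-out mappings on $[n]$. Let $d_{TV}(Y,Z):=\sup_A|P(Y\in A)-P(Z\in A)|$. If $\alpha=\beta\sqrt n$, then $$\lim_{n\to\infty} d_{TV}\bigl(X(M_{n,k}^{\alpha}),X(M_{n,k}^{\infty})\bigr)=\tfrac12\,\mathbb E\bigl|1-e^{-\mathcal N}\bigr|,$$ where $\mathcal N$ is a Gaussian random variable with mean $\frac{k^2}{4\beta^2}$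 and variance $\frac{k^2}{2\beta^2}$. -/

import Mathlib

noncomputable section

namespace KOut

/-- `k`-out mappings on the vertex set `Fin n`: `M v i` is the image of `v` under its arc with
label `i` (loops and multiple arcs are allowed). -/
abbrev KOutMap (n k : ℕ) : Type := Fin n → Fin k → Fin n

/-- Intermediate digraphs of the growth process: `M v i = some j` if the arc of `v` with label `i`
has been inserted and points to `j`, and `M v i = none` if it has not been inserted yet. -/
abbrev PartialMap (n k : ℕ) : Type := Fin n → Fin k → Option (Fin n)

variable {n k : ℕ}

namespace PartialMap

/-- Current out-degree of `v`. -/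
def outDeg (M : PartialMap n k) (v : Fin n) : ℕ :=
  (Finset.univ.filter fun i : Fin k => (M v i).isSome).card

/-- Current in-degree of `j`, with multiplicity. -/
def inDeg (M : PartialMap n k) (j : Fin n) : ℕ :=
  (Finset.univ.filter fun p : Fin n × Fin k => M p.1 p.2 = some j).card

/-- Current weight of `j`: the initial weight `α`, plus one for each arc that points to `j`. -/
def weight (α : ℝ) (M : PartialMap n k) (j : Fin n) : ℝ := α + inDeg M j

/-- The vertices whose out-degree is below `k`. -/
def openVertices (M : PartialMap n k) : Finset (Fin n) :=
  Finset.univ.filter fun v => outDeg M v < k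

/-- Insert an arc from `v` to `j`. The arcs of `v` are labelled chronologically, so the new arc
gets the label `outDeg M v` (labels start at `0`). -/
def addArc (M : PartialMap n k) (v j : Fin n) : PartialMap n k :=
  Function.update M v fun i => if (i : ℕ) = outDeg M v then some j else M v i

theorem sum_target_eq_one {α : ℝ} (hα : 0 < α) (M : PartialMap n k) (v : Fin n) :
    ∑ j, ENNReal.ofReal (weight α M j / ∑ i, weight α M i) = 1 := by
  have hw : ∀ j, 0 < weight α M j := fun j => by unfold weight; positivity
  have hs : 0 < ∑ i, weight α M i := Finset.sum_pos (fun j _ => hw j) ⟨v, Finset.mem_univ v⟩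
  rw [← ENNReal.ofReal_sum_of_nonneg fun j _ => (div_pos (hw j) hs).le, ← Finset.sum_div,
    div_self hs.ne', ENNReal.ofReal_one]

/-- Law of the target selected by the vertex `v`: the target is `j` with probability
proportional to the current weight of `j`. (Only `α > 0` is meaningful; the other branch is a
default value.) -/
def targetLaw (α : ℝ) (M : PartialMap n k) (v : Fin n) : PMF (Fin n) :=
  if hα : 0 < α then
    PMF.ofFintype (fun j => ENNReal.ofReal (weight α M j / ∑ i, weight α M i))
      (sum_target_eq_one hα M v)
  else PMF.pure v

/-- One step of the process: choose uniformly at random a vertex with out-degree below `k`, let it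
select its target with probability proportional to the current weights, and insert the arc.
If there is no such vertex, the digraph is complete and does not change. -/
def step (α : ℝ) (M : PartialMap n k) : PMF (PartialMap n k) :=
  if h : (openVertices M).Nonempty then
    (PMF.uniformOfFinset (openVertices M) h).bind fun v => (targetLaw α M v).map (addArc M v)
  else PMF.pure M

/-- Law of the digraph after `t` steps, starting with the empty digraph. -/
def evolve (n k : ℕ) (α : ℝ) : ℕ → PMF (PartialMap n k)
  | 0 => PMF.pure fun _ _ => none
  | t + 1 => (evolve n k α t).bind (step α)

/-- Read a complete digraph as a `k`-out mapping. (After `k * n` steps all arcs are present, so the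
default value is not used.) -/
def toKOutMap (M : PartialMap n k) : KOutMap n k := fun v i => (M v i).getD v

end PartialMap

/-- Law of the preferential attachment `k`-out mapping with parameter `α`. -/
def prefAttachLaw (n k : ℕ) (α : ℝ) : PMF (KOutMap n k) :=
  (PartialMap.evolve n k α (k * n)).map PartialMap.toKOutMap

/-- Law of the uniformly random `k`-out mapping. -/
def uniformLaw (n k : ℕ) : PMF (KOutMap n k) :=
  haveI : Nonempty (KOutMap n k) := ⟨fun v _ => v⟩
  PMF.uniformOfFintype (KOutMap n k)

/-- In-degree of `j` in the `k`-out mapping `M`, with multiplicity. -/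
def inDegree (M : KOutMap n k) (j : Fin n) : ℕ :=
  (Finset.univ.filter fun p : Fin n × Fin k => M p.1 p.2 = j).card

/-- The sum of the squared in-degrees. -/
def sumSqInDegree (M : KOutMap n k) : ℕ := ∑ j, inDegree M j ^ 2

/-- Total variation distance of two discrete laws, `sup_A |p(A) - q(A)|` over all events `A`. -/
def tvDist {Ω : Type*} (p q : PMF Ω) : ℝ :=
  ⨆ A : Set Ω, |(p.toOuterMeasure A).toReal - (q.toOuterMeasure A).toReal|

end KOut

end

/-! ### The exact law of the preferential attachment mapping. -/

noncomputable section

namespace KOut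

variable {n k : ℕ}

/-! The order in which vertices are chosen does not matter: the chain of target probabilities
telescopes, and a mapping `F` has probability equal to the product of the rising factorials of `α`
of lengths the in-degrees, divided by the rising factorial of `α * n` of length `k * n`
(`prefAttachLaw_apply`). Relative to the uniform law, the likelihood ratio is thus `exp Λ`, where
`Λ` is a sum of terms `log (1 + i / α)` minus a constant.

For `α = β √n`, expand the logarithms to second order. The first-order part is `W / α`, with `W` the
centred number of pairs of arcs that share a target. The second-order part concentrates at `-k² /
(4β²)`, and the remainder is `O(1 / √n)` in mean (`expect_abs_logRatio_sub_le`). Since `∑ D_j² = 2 ·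
(number of pairs) + kn`, `Λ` is asymptotically a function of `X`, so passing from the mapping to `X`
loses no total variation in the limit.

A Stein-type argument on characteristic functions, resampling one arc at a time, shows that `W / √n`
is asymptotically normal with variance `k² / 2` (`norm_collisionCharFun_mul_exp_sub_one_le`). Under
the uniform law `Λ` therefore tends to a Gaussian `Z` with variance `v = k² / (2β²)` and mean `-v /
2`, so `E e^Z = 1`. The distance tends to `E (1 - e^Z)⁺ = ½ E |1 - e^Z|`, with `𝒩 = -Z`. The upper
bound (`tvDist_map_le`) holds for every statistic; the lower bound (`le_tvDist_map`) tests the event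
that the approximate log-likelihood, read off from `X`, is negative. -/

/-- The rising factorial `a (a + 1) ⋯ (a + d - 1)`. -/
def risingFactorial (a : ℝ) (d : ℕ) : ℝ := ∏ i ∈ Finset.range d, (a + i)

theorem risingFactorial_pos {a : ℝ} (ha : 0 < a) (d : ℕ) : 0 < risingFactorial a d :=
  Finset.prod_pos fun i _ => by positivity

theorem risingFactorial_succ (a : ℝ) (d : ℕ) :
    risingFactorial a (d + 1) = risingFactorial a d * (a + d) :=
  Finset.prod_range_succ _ _

namespace PartialMap

/-- The labels of the inserted arcs of every vertex form an initial segment. -/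
def WellFormed (M : PartialMap n k) : Prop :=
  ∀ v i, (M v i).isSome ↔ (i : ℕ) < outDeg M v

/-- The mapping `F` contains all arcs of the partial mapping `M`. -/
def ExtendsTo (M : PartialMap n k) (F : KOutMap n k) : Prop :=
  ∀ v i j, M v i = some j → F v i = j

/-- Number of arcs inserted so far. -/
def numArcs (M : PartialMap n k) : ℕ := ∑ j, inDeg M j

theorem numArcs_eq_sum_outDeg (M : PartialMap n k) : numArcs M = ∑ v, outDeg M v := by
  unfold numArcs inDeg outDeg
  simp only [Finset.card_filter, Fintype.sum_prod_type]
  rw [Finset.sum_comm]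
  refine Finset.sum_congr rfl fun v _ => ?_
  rw [Finset.sum_comm]
  refine Finset.sum_congr rfl fun i _ => ?_
  cases h : M v i <;> simp

theorem outDeg_le (M : PartialMap n k) (v : Fin n) : outDeg M v ≤ k :=
  (Finset.card_filter_le _ _).trans_eq (by simp)

theorem WellFormed.eq_none {M : PartialMap n k} (hM : WellFormed M) {v : Fin n} {i : Fin k}
    (hi : (i : ℕ) = outDeg M v) : M v i = none := by
  have := (hM v i).not.mpr (by omega)
  simpa using this

theorem inDeg_addArc {M : PartialMap n k} (hM : WellFormed M) {v : Fin n}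
    (hv : outDeg M v < k) (j j' : Fin n) :
    inDeg (addArc M v j) j' = inDeg M j' + if j' = j then 1 else 0 := by
  unfold inDeg
  simp only [Finset.card_filter, Fintype.sum_prod_type]
  rw [← Finset.add_sum_erase _ _ (Finset.mem_univ v),
    ← Finset.add_sum_erase (Finset.univ) (fun x => ∑ i, if M x i = some j' then 1 else 0)
      (Finset.mem_univ v)]
  have h1 : ∀ x ∈ Finset.univ.erase v, (∑ i, if addArc M v j x i = some j' then 1 else 0)
      = ∑ i, if M x i = some j' then 1 else 0 := fun x hx => by
    simp [addArc, Function.update_of_ne (Finset.ne_of_mem_erase hx)]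
  rw [Finset.sum_congr rfl h1, add_right_comm]
  congr 1
  have h2 : ∀ i : Fin k, (if addArc M v j v i = some j' then 1 else 0)
      = (if M v i = some j' then 1 else 0)
        + if i = ⟨outDeg M v, hv⟩ then (if j' = j then 1 else 0) else 0 := by
    intro i
    by_cases hi : (i : ℕ) = outDeg M v
    · simp [addArc, hi, hM.eq_none hi, Fin.ext_iff, eq_comm]
    · simp [addArc, hi, Fin.ext_iff]
  simp only [h2, Finset.sum_add_distrib, Finset.sum_ite_eq', Finset.mem_univ, if_true]

theorem numArcs_addArc {M : PartialMap n k} (hM : WellFormed M) {v : Fin n}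
    (hv : outDeg M v < k) (j : Fin n) : numArcs (addArc M v j) = numArcs M + 1 := by
  simp [numArcs, inDeg_addArc hM hv, Finset.sum_add_distrib]

theorem outDeg_addArc_self {M : PartialMap n k} (hM : WellFormed M) {v : Fin n}
    (hv : outDeg M v < k) (j : Fin n) : outDeg (addArc M v j) v = outDeg M v + 1 := by
  have h2 : ∀ i : Fin k, (if (addArc M v j v i).isSome then 1 else 0)
      = (if (M v i).isSome then 1 else 0) + if i = ⟨outDeg M v, hv⟩ then 1 else 0 := by
    intro i
    by_cases hi : (i : ℕ) = outDeg M v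
    · simp [addArc, hi, hM.eq_none hi, Fin.ext_iff]
    · simp [addArc, hi, Fin.ext_iff]
  conv_lhs => unfold outDeg
  rw [Finset.card_filter]
  simp only [h2, Finset.sum_add_distrib, Finset.sum_ite_eq', Finset.mem_univ, if_true]
  rw [← Finset.card_filter]
  rfl

theorem outDeg_addArc_of_ne (M : PartialMap n k) {v x : Fin n} (hx : x ≠ v) (j : Fin n) :
    outDeg (addArc M v j) x = outDeg M x := by
  simp [outDeg, addArc, Function.update_of_ne hx]

theorem WellFormed.addArc {M : PartialMap n k} (hM : WellFormed M) {v : Fin n}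
    (hv : outDeg M v < k) (j : Fin n) : WellFormed (addArc M v j) := by
  intro x i
  by_cases hx : x = v
  · subst hx
    rw [outDeg_addArc_self hM hv]
    by_cases hi : (i : ℕ) = outDeg M x
    · simp [PartialMap.addArc, hi]
    · have := hM x i
      simp only [PartialMap.addArc, Function.update_self, hi, if_false, this]
      omega
  · rw [outDeg_addArc_of_ne M hx]
    simpa [PartialMap.addArc, Function.update_of_ne hx] using hM x i

theorem extendsTo_addArc {M : PartialMap n k} (hM : WellFormed M) {v : Fin n}
    (hv : outDeg M v < k) (j : Fin n) (F : KOutMap n k) :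
    ExtendsTo (PartialMap.addArc M v j) F ↔ ExtendsTo M F ∧ j = F v ⟨outDeg M v, hv⟩ := by
  constructor
  · refine fun h => ⟨fun x i y hxy => ?_, ?_⟩
    · refine h x i y ?_
      by_cases hx : x = v
      · subst hx
        have hi : (i : ℕ) ≠ outDeg M x := fun hi => by simp [hM.eq_none hi] at hxy
        simpa [PartialMap.addArc, hi] using hxy
      · simpa [PartialMap.addArc, Function.update_of_ne hx] using hxy
    · exact (h v ⟨outDeg M v, hv⟩ j (by simp [PartialMap.addArc])).symm
  · rintro ⟨h, rfl⟩ x i y hxy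
    by_cases hx : x = v
    · subst hx
      by_cases hi : (i : ℕ) = outDeg M x
      · have : i = ⟨outDeg M x, hv⟩ := Fin.ext hi
        subst this
        simpa [PartialMap.addArc] using hxy
      · exact h x i y (by simpa [PartialMap.addArc, hi] using hxy)
    · exact h x i y (by simpa [PartialMap.addArc, Function.update_of_ne hx] using hxy)

/-- The probability that a sequence of preferentially selected targets produces given arcs,
as a function of the in-degrees. -/
def urnWeight (α : ℝ) (M : PartialMap n k) : ℝ :=
  (∏ j, risingFactorial α (inDeg M j)) / risingFactorial (α * n) (numArcs M)

theorem urnWeight_pos {α : ℝ} (hα : 0 < α) (hn : 0 < n) (M : PartialMap n k) :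
    0 < urnWeight α M :=
  div_pos (Finset.prod_pos fun _ _ => risingFactorial_pos hα _)
    (risingFactorial_pos (by positivity) _)

theorem sum_weight (α : ℝ) (M : PartialMap n k) :
    ∑ i, weight α M i = α * n + numArcs M := by
  simp [weight, numArcs, Finset.sum_add_distrib, mul_comm]

/-- Only the factor of `j` grows in the numerator, by `α + inDeg M j`; the denominator gains `α * n
+ numArcs M`, which is the total weight. This is the telescoping step. -/
theorem urnWeight_addArc (α : ℝ) {M : PartialMap n k} (hM : WellFormed M) {v : Fin n}
    (hv : outDeg M v < k) (j : Fin n) :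
    urnWeight α (addArc M v j) = urnWeight α M * (weight α M j / ∑ i, weight α M i) := by
  have h : ∀ x, risingFactorial α (inDeg (PartialMap.addArc M v j) x)
      = risingFactorial α (inDeg M x) * if x = j then weight α M j else 1 := by
    intro x
    rw [inDeg_addArc hM hv]
    split_ifs with hx
    · subst hx
      rw [risingFactorial_succ, weight]
    · simp
  rw [urnWeight, numArcs_addArc hM hv, risingFactorial_succ, sum_weight]
  simp only [h, Finset.prod_mul_distrib, Finset.prod_ite_eq', Finset.mem_univ, if_true]
  rw [urnWeight, div_mul_div_comm]

/-- Law of the digraph after `r` further steps from `M`. -/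
def run (α : ℝ) : ℕ → PartialMap n k → PMF (PartialMap n k)
  | 0, M => PMF.pure M
  | r + 1, M => (step α M).bind (run α r)

/-- `evolve` adds steps at the end, `run` at the start; the latter suits an induction on the number
of remaining steps from an arbitrary state. -/
theorem evolve_bind_run (α : ℝ) (t r : ℕ) :
    (evolve n k α t).bind (run α r) = evolve n k α (t + r) := by
  induction r generalizing t with
  | zero => exact PMF.bind_pure _
  | succ r ih =>
    have := ih (t + 1)
    rw [show t + 1 + r = t + (r + 1) by ring] at this
    rw [← this]
    exact (PMF.bind_bind _ _ _).symm

/-- The urn weight of a complete mapping. -/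
def _root_.KOut.completeWeight (α : ℝ) (F : KOutMap n k) : ℝ :=
  (∏ j, risingFactorial α (inDegree F j)) / risingFactorial (α * n) (k * n)

theorem map_run_zero {α : ℝ} (hα : 0 < α) (hn : 0 < n) {M : PartialMap n k}
    (hM : WellFormed M) (h : numArcs M = k * n) (F : KOutMap n k) [Decidable (ExtendsTo M F)] :
    (PMF.pure M).map toKOutMap F =
      if ExtendsTo M F then ENNReal.ofReal (completeWeight α F / urnWeight α M) else 0 := by
  -- Out-degrees are at most `k` and sum to `k * n`, so all are equal to `k`.
  have hk : ∀ v, outDeg M v = k := by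
    have h1 : ∑ v, outDeg M v = ∑ _v : Fin n, k := by
      rw [← numArcs_eq_sum_outDeg, h]
      simp [mul_comm]
    exact fun v =>
      (Finset.sum_eq_sum_iff_of_le fun v _ => outDeg_le M v).mp h1 v (Finset.mem_univ v)
  have hs : ∀ v i, ∃ j, M v i = some j := fun v i =>
    Option.isSome_iff_exists.mp ((hM v i).mpr (by rw [hk v]; exact i.2))
  have hE : ExtendsTo M F ↔ F = toKOutMap M := by
    constructor
    · intro hF
      funext v i
      obtain ⟨j, hj⟩ := hs v i
      rw [hF v i j hj]
      simp [toKOutMap, hj]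
    · rintro rfl v i j hj
      simp [toKOutMap, hj]
  rw [PMF.pure_map, PMF.pure_apply]
  simp only [hE]
  split_ifs with hF
  · have hD : ∀ j, inDegree F j = inDeg M j := fun j => by
      unfold inDegree inDeg
      congr 1
      ext p
      obtain ⟨x, hx⟩ := hs p.1 p.2
      simp [hF, toKOutMap, hx]
    have : completeWeight α F = urnWeight α M := by
      simp [completeWeight, urnWeight, hD, h]
    rw [this, div_self (urnWeight_pos hα hn M).ne', ENNReal.ofReal_one]
  · rfl

-- Whichever open vertex `v` is chosen, only the target prescribed by `F` keeps `F` reachable, and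
-- its probability is a ratio of consecutive urn weights. The resulting value does not depend on
-- `v`, so averaging over `v` is harmless.
open Classical in
theorem map_run {α : ℝ} (hα : 0 < α) (hn : 0 < n) (F : KOutMap n k) (r : ℕ)
    {M : PartialMap n k} (hM : WellFormed M) (h : numArcs M + r = k * n) :
    (run α r M).map toKOutMap F =
      if ExtendsTo M F then ENNReal.ofReal (completeWeight α F / urnWeight α M) else 0 := by
  induction r generalizing M with
  | zero => exact map_run_zero hα hn hM h F
  | succ r ih =>
    have hne : (openVertices M).Nonempty := by
      by_contra hcon
      have h1 : ∀ v, k ≤ outDeg M v := fun v => by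
        by_contra hv
        exact hcon ⟨v, by simpa [openVertices] using hv⟩
      have h2 : ∑ _v : Fin n, k ≤ ∑ v, outDeg M v := Finset.sum_le_sum fun v _ => h1 v
      rw [← numArcs_eq_sum_outDeg] at h2
      simp only [Finset.sum_const, Finset.card_univ, Fintype.card_fin, smul_eq_mul] at h2
      nlinarith
    have hterm : ∀ v ∈ openVertices M, (((targetLaw α M v).map (addArc M v)).bind
        (run α r)).map toKOutMap F =
        if ExtendsTo M F then ENNReal.ofReal (completeWeight α F / urnWeight α M) else 0 := by
      intro v hv
      have hv : outDeg M v < k := by simpa [openVertices] using hv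
      rw [PMF.bind_map, PMF.map_bind, PMF.bind_apply, tsum_fintype]
      have hj : ∀ j, targetLaw α M v j *
          (((run α r ∘ addArc M v) j).map toKOutMap) F =
          if j = F v ⟨outDeg M v, hv⟩ then (if ExtendsTo M F then
            ENNReal.ofReal (completeWeight α F / urnWeight α M) else 0) else 0 := by
        intro j
        rw [Function.comp_apply, ih (hM.addArc hv j) (by rw [numArcs_addArc hM hv]; omega)]
        simp only [extendsTo_addArc hM hv]
        by_cases hF : ExtendsTo M F <;> by_cases hjF : j = F v ⟨outDeg M v, hv⟩ <;>
          simp only [hF, hjF, and_self, and_true, and_false, if_true, if_false, mul_zero]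
        rw [targetLaw, dif_pos hα, PMF.ofFintype_apply, urnWeight_addArc α hM hv]
        have hw : ∀ x, 0 < weight α M x := fun x => by unfold weight; positivity
        have hsum : 0 < ∑ i, weight α M i :=
          Finset.sum_pos (fun j _ => hw j) ⟨v, Finset.mem_univ v⟩
        rw [← ENNReal.ofReal_mul (div_pos (hw _) hsum).le]
        congr 1
        have := (urnWeight_pos hα hn M).ne'
        have := (hw (F v ⟨outDeg M v, hv⟩)).ne'
        have := hsum.ne'
        field_simp
      simp only [hj, Finset.sum_ite_eq', Finset.mem_univ, if_true]
    rw [run, step, dif_pos hne, PMF.bind_bind, PMF.map_bind, PMF.bind_apply, tsum_fintype]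
    have hv : ∀ v, PMF.uniformOfFinset (openVertices M) hne v *
        ((((targetLaw α M v).map (addArc M v)).bind (run α r)).map toKOutMap F) =
        PMF.uniformOfFinset (openVertices M) hne v *
        if ExtendsTo M F then ENNReal.ofReal (completeWeight α F / urnWeight α M) else 0 := by
      intro v
      by_cases hv : v ∈ openVertices M
      · rw [hterm v hv]
      · rw [PMF.uniformOfFinset_apply_of_notMem hne hv, zero_mul, zero_mul]
    simp only [hv]
    rw [← Finset.sum_mul, ← tsum_fintype (L := .unconditional _), PMF.tsum_coe, one_mul]

end PartialMap

theorem prefAttachLaw_apply {α : ℝ} (hα : 0 < α) (hn : 0 < n) (F : KOutMap n k) :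
    prefAttachLaw n k α F = ENNReal.ofReal (completeWeight α F) := by
  have hin : ∀ j, PartialMap.inDeg (fun _ _ => none : PartialMap n k) j = 0 := fun j => by
    simp [PartialMap.inDeg]
  have hnum : PartialMap.numArcs (fun _ _ => none : PartialMap n k) = 0 := by
    simp [PartialMap.numArcs, hin]
  have h := PartialMap.evolve_bind_run (n := n) (k := k) α 0 (k * n)
  rw [zero_add] at h
  classical
  have hE : PartialMap.ExtendsTo (fun _ _ => none) F := fun v i j hj => by simp at hj
  rw [prefAttachLaw, ← h, PartialMap.evolve, PMF.pure_bind,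
    PartialMap.map_run hα hn F (k * n) (fun v i => by simp [PartialMap.outDeg])
      (by rw [hnum, zero_add]),
    if_pos hE]
  simp [PartialMap.urnWeight, hin, hnum, risingFactorial]

end KOut

end

/-! ### Moments of the occupancy numbers under the uniform law. -/

noncomputable section

namespace KOut

open Finset
open scoped BigOperators

section Occupancy

variable {ι : Type*} [Fintype ι] {n : ℕ}

/-- The number of indices that are mapped to `j`. -/
def fiberCard (J : ι → Fin n) (j : Fin n) : ℕ := #{s | J s = j}

/-- The number of `a`-subsets of `ι` on which `J` is constant (for `a > 0`). -/
def sumChoose (a : ℕ) (J : ι → Fin n) : ℝ := ∑ j, ((fiberCard J j).choose a : ℝ)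

theorem sum_fiberCard (J : ι → Fin n) : ∑ j, fiberCard J j = Fintype.card ι := by
  simpa [fiberCard] using (card_eq_sum_card_fiberwise (s := (univ : Finset ι)) (t := univ)
    (f := J) (by simp)).symm

variable [DecidableEq ι]

theorem expect_prod (f : ι → Fin n → ℝ) :
    𝔼 J : ι → Fin n, ∏ s, f s (J s) = ∏ s, 𝔼 x, f s x := by
  simp only [Fintype.expect_eq_sum_div_card]
  rw [prod_div_distrib, prod_univ_sum, Fintype.piFinset_univ]
  simp

/-- Resampling one coordinate does not change a uniform average. -/
theorem expect_update {E : Type*} [AddCommMonoid E] [Module ℚ≥0 E] (t : ι)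
    (F : (ι → Fin n) → E) :
    𝔼 J : ι → Fin n, 𝔼 x, F (Function.update J t x) = 𝔼 J, F J := by
  rcases Nat.eq_zero_or_pos n with rfl | hn
  · have : IsEmpty (ι → Fin 0) := ⟨fun J => (J t).elim0⟩
    simp [Finset.univ_eq_empty]
  have : Nonempty (Fin n) := ⟨⟨0, hn⟩⟩
  have h : 𝔼 J : ι → Fin n, F J = 𝔼 p : (ι → Fin n) × Fin n, F p.1 := by
    rw [← univ_product_univ, expect_product]
    simp [expect_const univ_nonempty]
  have h' : 𝔼 J : ι → Fin n, 𝔼 x, F (Function.update J t x)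
      = 𝔼 p : (ι → Fin n) × Fin n, F (Function.update p.1 t p.2) := by
    rw [← univ_product_univ, expect_product]
  rw [h, h']
  -- Exchanging `J t` with the fresh value is an involution on pairs.
  refine expect_nbij' (fun p => (Function.update p.1 t p.2, p.1 t))
    (fun p => (Function.update p.1 t p.2, p.1 t)) ?_ ?_ ?_ ?_ ?_ <;> simp

/-- Counting `a`-subsets of the fibre by products over coordinates lets `expect_prod` factor the
averages. -/
theorem choose_fiberCard (J : ι → Fin n) (j : Fin n) (a : ℕ) :
    ((fiberCard J j).choose a : ℝ) = ∑ S ∈ powersetCard a (univ : Finset ι),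
      ∏ s, if s ∈ S then (if J s = j then (1 : ℝ) else 0) else 1 := by
  rw [fiberCard, ← card_powersetCard]
  have h : ∀ S : Finset ι, (∏ s, if s ∈ S then (if J s = j then (1 : ℝ) else 0) else 1)
      = if S ⊆ ({s | J s = j} : Finset ι) then 1 else 0 := by
    intro S
    rw [prod_ite_mem, univ_inter]
    split_ifs with hS
    · exact prod_eq_one fun s hs => if_pos (by simpa using hS hs)
    · obtain ⟨s, hs, hsj⟩ := not_subset.mp hS
      exact prod_eq_zero hs (if_neg (by simpa using hsj))
  simp only [h, sum_boole]
  congr 2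
  ext S
  simp [mem_powersetCard, and_comm]

theorem expect_ite_eq_one (j : Fin n) :
    𝔼 x : Fin n, (if x = j then (1 : ℝ) else 0) = 1 / n := by
  simp

theorem expect_choose_fiberCard (hn : 0 < n) (j : Fin n) (a : ℕ) :
    𝔼 J : ι → Fin n, ((fiberCard J j).choose a : ℝ)
      = (Fintype.card ι).choose a / (n : ℝ) ^ a := by
  have : Nonempty (Fin n) := ⟨⟨0, hn⟩⟩
  simp only [choose_fiberCard]
  rw [expect_sum_comm]
  have h : ∀ S ∈ powersetCard a (univ : Finset ι), 𝔼 J : ι → Fin n,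
      (∏ s, if s ∈ S then (if J s = j then (1 : ℝ) else 0) else 1) = (1 / n) ^ a := by
    intro S hS
    rw [expect_prod (fun s x => if s ∈ S then (if x = j then (1 : ℝ) else 0) else 1)]
    have : ∀ s, 𝔼 x : Fin n, (if s ∈ S then (if x = j then (1 : ℝ) else 0) else 1)
        = if s ∈ S then (1 / n : ℝ) else 1 := by
      intro s
      split_ifs
      · exact expect_ite_eq_one j
      · exact expect_const univ_nonempty _
    simp only [this, prod_ite_mem, univ_inter, prod_const, (mem_powersetCard.mp hS).2]
  rw [sum_congr rfl h]
  simp [card_powersetCard, div_eq_mul_inv]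

/-- Negative correlation: disjoint index sets contribute exactly the product, overlapping ones
contribute zero because one index cannot be mapped to both `i` and `j`. -/
theorem expect_choose_mul_choose_le (hn : 0 < n) {i j : Fin n} (hij : i ≠ j) (a : ℕ) :
    𝔼 J : ι → Fin n, ((fiberCard J i).choose a : ℝ) * (fiberCard J j).choose a
      ≤ ((Fintype.card ι).choose a / (n : ℝ) ^ a) ^ 2 := by
  have : Nonempty (Fin n) := ⟨⟨0, hn⟩⟩
  simp only [choose_fiberCard, sum_mul_sum, ← prod_mul_distrib]
  rw [expect_sum_comm]
  simp only [expect_sum_comm]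
  have h : ∀ S ∈ powersetCard a (univ : Finset ι), ∀ T ∈ powersetCard a (univ : Finset ι),
      𝔼 J : ι → Fin n, (∏ s, (if s ∈ S then (if J s = i then (1 : ℝ) else 0) else 1) *
        (if s ∈ T then (if J s = j then (1 : ℝ) else 0) else 1)) ≤ (1 / n) ^ a * (1 / n) ^ a := by
    intro S hS T hT
    rw [expect_prod (fun s x => (if s ∈ S then (if x = i then (1 : ℝ) else 0) else 1) *
        (if s ∈ T then (if x = j then (1 : ℝ) else 0) else 1))]
    have h1 : ∀ s, 𝔼 x : Fin n, (if s ∈ S then (if x = i then (1 : ℝ) else 0) else 1) *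
        (if s ∈ T then (if x = j then (1 : ℝ) else 0) else 1)
        ≤ (if s ∈ S then (1 / n : ℝ) else 1) * if s ∈ T then (1 / n : ℝ) else 1 := by
      intro s
      by_cases hs : s ∈ S <;> by_cases ht : s ∈ T <;> simp only [hs, ht, if_true, if_false,
        mul_one, one_mul, expect_ite_eq_one, le_refl]
      · refine (expect_eq_zero fun x _ => ?_).trans_le (by positivity)
        by_cases hx : x = i
        · simp [hx, hij]
        · simp [hx]
      · exact (expect_const univ_nonempty _).le
    refine (prod_le_prod (fun s _ => expect_nonneg fun x _ => ?_) fun s _ => h1 s).trans_eq ?_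
    · split_ifs <;> norm_num
    · simp only [prod_mul_distrib, prod_ite_mem, univ_inter, prod_const,
        (mem_powersetCard.mp hS).2, (mem_powersetCard.mp hT).2]
  refine (sum_le_sum fun S hS => sum_le_sum fun T hT => h S hS T hT).trans_eq ?_
  simp only [sum_const, card_powersetCard, card_univ, nsmul_eq_mul]
  rw [one_div, inv_pow]
  ring

/-- The exponential moment of a binomial variable; the `2` comes from `e - 1 ≤ 2`. -/
theorem expect_exp_fiberCard_le (hn : 0 < n) (j : Fin n) :
    𝔼 J : ι → Fin n, Real.exp (fiberCard J j) ≤ Real.exp (2 * (Fintype.card ι / n)) := by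
  have : Nonempty (Fin n) := ⟨⟨0, hn⟩⟩
  have h : ∀ J : ι → Fin n, Real.exp (fiberCard J j) = ∏ s, (1 + (Real.exp 1 - 1) *
      if J s = j then (1 : ℝ) else 0) := by
    intro J
    rw [fiberCard, ← sum_boole, Real.exp_sum]
    refine prod_congr rfl fun s _ => ?_
    split_ifs <;> simp
  simp only [h]
  rw [expect_prod (fun _ x => (1 + (Real.exp 1 - 1) * if x = j then (1 : ℝ) else 0))]
  have h1 : 𝔼 x : Fin n, (1 + (Real.exp 1 - 1) * if x = j then (1 : ℝ) else 0)
      = 1 + (Real.exp 1 - 1) * (1 / n) := by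
    rw [expect_add_distrib, ← mul_expect, expect_ite_eq_one, expect_const univ_nonempty]
  have he : Real.exp 1 ≤ 3 := Real.exp_one_lt_three.le
  have he' : 0 ≤ Real.exp 1 - 1 := by linarith [Real.add_one_le_exp (1 : ℝ)]
  have hle : 1 + (Real.exp 1 - 1) * (1 / n) ≤ Real.exp (2 * (1 / n)) := by
    refine le_trans ?_ (Real.add_one_le_exp _)
    have : (Real.exp 1 - 1) * (1 / (n : ℝ)) ≤ 2 * (1 / n) := by gcongr; linarith
    linarith
  simp only [h1, prod_const]
  refine (pow_le_pow_left₀ (by positivity) hle _).trans_eq ?_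
  rw [← Real.exp_nat_mul, card_univ]
  congr 1
  ring

theorem expect_fiberCard_pow_le (hn : 0 < n) (j : Fin n) (r : ℕ) :
    𝔼 J : ι → Fin n, (fiberCard J j : ℝ) ^ r
      ≤ r.factorial * Real.exp (2 * (Fintype.card ι / n)) := by
  have h : ∀ J : ι → Fin n, (fiberCard J j : ℝ) ^ r ≤ r.factorial * Real.exp (fiberCard J j) := by
    intro J
    have := Real.pow_div_factorial_le_exp (fiberCard J j : ℝ) (Nat.cast_nonneg _) r
    rwa [div_le_iff₀ (by positivity), mul_comm] at this
  refine (expect_le_expect fun J _ => h J).trans ?_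
  rw [← mul_expect]
  exact mul_le_mul_of_nonneg_left (expect_exp_fiberCard_le hn j) (by positivity)

/-- A variance bound of order `n`: off-diagonal covariances are nonpositive, and each of the `n`
diagonal terms is at most a moment of order `2a`. -/
theorem expect_sumChoose_sub_sq_le (hn : 0 < n) (a : ℕ) :
    𝔼 J : ι → Fin n, (sumChoose a J - n * ((Fintype.card ι).choose a / (n : ℝ) ^ a)) ^ 2
      ≤ n * ((2 * a).factorial * Real.exp (2 * (Fintype.card ι / n))) := by
  have : Nonempty (Fin n) := ⟨⟨0, hn⟩⟩
  set p : ℝ := (Fintype.card ι).choose a / (n : ℝ) ^ a with hp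
  have hexp : ∀ J : ι → Fin n, (sumChoose a J - n * p) ^ 2
      = ∑ i, ∑ j, (((fiberCard J i).choose a : ℝ) * (fiberCard J j).choose a
        - p * (fiberCard J i).choose a - p * (fiberCard J j).choose a + p ^ 2) := by
    intro J
    have : sumChoose a J - n * p = ∑ j, (((fiberCard J j).choose a : ℝ) - p) := by
      simp [sumChoose]
    rw [this, sq, sum_mul_sum]
    refine sum_congr rfl fun i _ => sum_congr rfl fun j _ => ?_
    ring
  simp only [hexp]
  rw [expect_sum_comm]
  have hi : ∀ i : Fin n, 𝔼 J : ι → Fin n, ∑ j, (((fiberCard J i).choose a : ℝ) *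
      (fiberCard J j).choose a - p * (fiberCard J i).choose a - p * (fiberCard J j).choose a
        + p ^ 2) ≤ (2 * a).factorial * Real.exp (2 * (Fintype.card ι / n)) := by
    intro i
    rw [expect_sum_comm]
    have hij : ∀ j, 𝔼 J : ι → Fin n, (((fiberCard J i).choose a : ℝ) *
        (fiberCard J j).choose a - p * (fiberCard J i).choose a - p * (fiberCard J j).choose a
        + p ^ 2) = 𝔼 J : ι → Fin n, ((fiberCard J i).choose a : ℝ) * (fiberCard J j).choose a
          - p ^ 2 := by
      intro j
      rw [expect_add_distrib, expect_sub_distrib, expect_sub_distrib, ← mul_expect, ← mul_expect,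
        expect_choose_fiberCard hn, expect_choose_fiberCard hn, expect_const univ_nonempty, ← hp]
      ring
    simp only [hij]
    rw [← add_sum_erase _ _ (mem_univ i)]
    have h1 : ∑ j ∈ univ.erase i, (𝔼 J : ι → Fin n, ((fiberCard J i).choose a : ℝ) *
        (fiberCard J j).choose a - p ^ 2) ≤ 0 :=
      sum_nonpos fun j hj => sub_nonpos.mpr
        (expect_choose_mul_choose_le hn (ne_of_mem_erase hj).symm a)
    have h2 : 𝔼 J : ι → Fin n, ((fiberCard J i).choose a : ℝ) * (fiberCard J i).choose a
        ≤ (2 * a).factorial * Real.exp (2 * (Fintype.card ι / n)) := by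
      refine le_trans (expect_le_expect fun J _ => ?_) (expect_fiberCard_pow_le hn i (2 * a))
      rw [two_mul, pow_add]
      have : ((fiberCard J i).choose a : ℝ) ≤ (fiberCard J i : ℝ) ^ a := by
        exact_mod_cast Nat.choose_le_pow _ _
      gcongr
    linarith [sq_nonneg p]
  refine (sum_le_sum fun i _ => hi i).trans_eq ?_
  simp

end Occupancy

end KOut

end

/-! ### Collisions and the effect of resampling one arc. -/

noncomputable section

namespace KOut

open Finset
open scoped BigOperators

section Resampling

variable {ι : Type*} [Fintype ι] [DecidableEq ι] {n : ℕ}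

/-- The number of indices other than `t` that are mapped to `j`. -/
def fiberCardErase (t : ι) (J : ι → Fin n) (j : Fin n) : ℕ := #{s | s ≠ t ∧ J s = j}

theorem fiberCard_eq_erase_add (t : ι) (J : ι → Fin n) (j : Fin n) :
    fiberCard J j = fiberCardErase t J j + if J t = j then 1 else 0 := by
  simp only [fiberCard, fiberCardErase, card_filter]
  rw [← add_sum_erase _ _ (mem_univ t),
    ← add_sum_erase univ (fun s => if s ≠ t ∧ J s = j then 1 else 0) (mem_univ t)]
  rw [sum_congr rfl (g := fun s => if s ≠ t ∧ J s = j then 1 else 0)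
    fun s hs => by simp [ne_of_mem_erase hs]]
  simp [add_comm]

theorem fiberCardErase_le (t : ι) (J : ι → Fin n) (j : Fin n) :
    fiberCardErase t J j ≤ fiberCard J j := by
  rw [fiberCard_eq_erase_add t]
  exact Nat.le_add_right _ _

theorem fiberCardErase_update (t : ι) (J : ι → Fin n) (x j : Fin n) :
    fiberCardErase t (Function.update J t x) j = fiberCardErase t J j := by
  unfold fiberCardErase
  congr 1
  refine filter_congr fun s _ => and_congr_right fun hs => ?_
  rw [Function.update_of_ne hs]

theorem sum_fiberCardErase (t : ι) (J : ι → Fin n) :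
    ∑ j, (fiberCardErase t J j : ℝ) = Fintype.card ι - 1 := by
  have h := sum_fiberCard J
  simp only [fiberCard_eq_erase_add t, sum_add_distrib, sum_ite_eq, mem_univ, if_true] at h
  rw [← h]
  push_cast
  ring

/-- Pascal's rule isolates the contribution of `t`; the first sum is unchanged when `t` is
resampled. -/
theorem sumChoose_two_eq (t : ι) (J : ι → Fin n) :
    sumChoose 2 J = ∑ j, ((fiberCardErase t J j).choose 2 : ℝ) + fiberCardErase t J (J t) := by
  have h : ∀ j, ((fiberCard J j).choose 2 : ℝ) = (fiberCardErase t J j).choose 2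
      + if J t = j then (fiberCardErase t J j : ℝ) else 0 := by
    intro j
    rw [fiberCard_eq_erase_add t]
    split_ifs
    · rw [Nat.choose_succ_succ' _ 1, Nat.choose_one_right]
      push_cast
      ring
    · simp
  simp [sumChoose, h, sum_add_distrib]

theorem two_mul_sumChoose_two (J : ι → Fin n) :
    2 * sumChoose 2 J = ∑ t, (fiberCardErase t J (J t) : ℝ) := by
  have h : ∀ t, (fiberCardErase t J (J t) : ℝ) = fiberCard J (J t) - 1 := fun t => by
    rw [fiberCard_eq_erase_add t]
    simp
  simp only [h]
  rw [← sum_fiberwise univ J, sumChoose, mul_sum]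
  refine sum_congr rfl fun j _ => ?_
  rw [sum_congr rfl (g := fun _ => (fiberCard J j : ℝ) - 1)
    fun t ht => by rw [(mem_filter.mp ht).2], sum_const, Nat.cast_choose_two, fiberCard]
  simp only [nsmul_eq_mul]
  ring

theorem sum_fiberCardErase_sq (t : ι) (J : ι → Fin n) :
    ∑ j, (fiberCardErase t J j : ℝ) ^ 2
      = 2 * ∑ j, ((fiberCardErase t J j).choose 2 : ℝ) + (Fintype.card ι - 1) := by
  rw [← sum_fiberCardErase t J, mul_sum, ← sum_add_distrib]
  refine sum_congr rfl fun j _ => ?_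
  rw [Nat.cast_choose_two]
  ring

/-- The number of colliding pairs, centred. -/
def collisions (J : ι → Fin n) : ℝ :=
  sumChoose 2 J - (Fintype.card ι : ℝ) * (Fintype.card ι - 1) / (2 * n)

/-- The number of collisions of `t` with other indices if `t` is mapped to `x`, centred. -/
def collisionsAt (t : ι) (J : ι → Fin n) (x : Fin n) : ℝ :=
  fiberCardErase t J x - ((Fintype.card ι : ℝ) - 1) / n

theorem collisionsAt_update (t : ι) (J : ι → Fin n) (x y : Fin n) :
    collisionsAt t (Function.update J t x) y = collisionsAt t J y := by
  rw [collisionsAt, fiberCardErase_update, collisionsAt]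

theorem collisions_update (t : ι) (J : ι → Fin n) (x : Fin n) :
    collisions (Function.update J t x)
      = collisions J - collisionsAt t J (J t) + collisionsAt t J x := by
  simp only [collisions, collisionsAt, sumChoose_two_eq t, fiberCardErase_update,
    Function.update_self]
  ring

theorem two_mul_collisions (J : ι → Fin n) :
    2 * collisions J = ∑ t, collisionsAt t J (J t) := by
  simp only [collisionsAt, sum_sub_distrib, ← two_mul_sumChoose_two, collisions, sum_const,
    card_univ, nsmul_eq_mul]
  ring

theorem expect_collisionsAt (hn : 0 < n) (t : ι) (J : ι → Fin n) :
    𝔼 x, collisionsAt t J x = 0 := by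
  have : (n : ℝ) ≠ 0 := by positivity
  rw [Fintype.expect_eq_sum_div_card]
  simp only [collisionsAt, sum_sub_distrib, sum_fiberCardErase, sum_const, card_univ,
    Fintype.card_fin, nsmul_eq_mul]
  field_simp
  simp

theorem expect_collisions_sq_le (hn : 0 < n) {k : ℕ} (hm : Fintype.card ι = k * n) :
    𝔼 J : ι → Fin n, collisions J ^ 2 ≤ n * (24 * Real.exp (2 * k)) := by
  have hn' : (n : ℝ) ≠ 0 := by positivity
  have h := expect_sumChoose_sub_sq_le (ι := ι) hn 2
  have h1 : (n : ℝ) * ((Fintype.card ι).choose 2 / (n : ℝ) ^ 2)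
      = (Fintype.card ι : ℝ) * (Fintype.card ι - 1) / (2 * n) := by
    rw [Nat.cast_choose_two]
    field_simp
  have h2 : (Fintype.card ι : ℝ) / n = k := by
    rw [hm]
    push_cast
    field_simp
  rw [h1, h2] at h
  simpa [collisions, Nat.factorial] using h

theorem abs_collisionsAt_le (hn : 0 < n) {k : ℕ} (hm : Fintype.card ι = k * n) (t : ι)
    (J : ι → Fin n) (x : Fin n) : |collisionsAt t J x| ≤ fiberCardErase t J x + k := by
  have h1 : (1 : ℝ) ≤ Fintype.card ι := by exact_mod_cast Fintype.card_pos_iff.mpr ⟨t⟩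
  have h2 : ((Fintype.card ι : ℝ) - 1) / n ≤ k := by
    rw [div_le_iff₀ (by positivity), hm]
    push_cast
    linarith
  have h3 : 0 ≤ ((Fintype.card ι : ℝ) - 1) / n := div_nonneg (by linarith) (by positivity)
  have h4 : (0 : ℝ) ≤ fiberCardErase t J x := by positivity
  rw [collisionsAt, abs_le]
  constructor <;> linarith

theorem expect_fiberCardErase_pow_le (hn : 0 < n) {k : ℕ} (hm : Fintype.card ι = k * n) (t : ι)
    (r : ℕ) : 𝔼 J : ι → Fin n, 𝔼 x, (fiberCardErase t J x : ℝ) ^ r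
      ≤ r.factorial * Real.exp (2 * k) := by
  have : Nonempty (Fin n) := ⟨⟨0, hn⟩⟩
  have h2 : (Fintype.card ι : ℝ) / n = k := by
    rw [hm]
    push_cast
    field_simp
  rw [expect_comm]
  refine (expect_le_expect fun x _ => ?_).trans_eq (expect_const univ_nonempty _)
  rw [← h2]
  refine le_trans (expect_le_expect fun J _ => ?_) (expect_fiberCard_pow_le hn x r)
  have := fiberCardErase_le t J x
  gcongr

theorem expect_abs_collisionsAt_le (hn : 0 < n) {k : ℕ} (hm : Fintype.card ι = k * n) (t : ι) :
    𝔼 J : ι → Fin n, 𝔼 x, |collisionsAt t J x| ≤ Real.exp (2 * k) + k := by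
  have : Nonempty (Fin n) := ⟨⟨0, hn⟩⟩
  refine (expect_le_expect fun J _ => expect_le_expect fun x _ =>
    abs_collisionsAt_le hn hm t J x).trans ?_
  simp only [expect_add_distrib, expect_const univ_nonempty]
  have := expect_fiberCardErase_pow_le hn hm t 1
  simp only [pow_one, Nat.factorial_one, Nat.cast_one, one_mul] at this
  linarith

theorem expect_abs_collisionsAt_pow_three_le (hn : 0 < n) {k : ℕ} (hm : Fintype.card ι = k * n)
    (t : ι) :
    𝔼 J : ι → Fin n, 𝔼 x, |collisionsAt t J x| ^ 3 ≤ 24 * Real.exp (2 * k) + 4 * k ^ 3 := by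
  have : Nonempty (Fin n) := ⟨⟨0, hn⟩⟩
  have h : ∀ (J : ι → Fin n) (x : Fin n), |collisionsAt t J x| ^ 3
      ≤ 4 * (fiberCardErase t J x : ℝ) ^ 3 + 4 * (k : ℝ) ^ 3 := by
    intro J x
    refine (pow_le_pow_left₀ (abs_nonneg _) (abs_collisionsAt_le hn hm t J x) 3).trans ?_
    have := add_pow_le (a := (fiberCardErase t J x : ℝ)) (b := k) (by positivity) (by positivity) 3
    norm_num at this
    linarith
  refine (expect_le_expect fun J _ => expect_le_expect fun x _ => h J x).trans ?_
  simp only [expect_add_distrib, expect_const univ_nonempty, ← mul_expect]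
  have := expect_fiberCardErase_pow_le hn hm t 3
  norm_num [Nat.factorial] at this
  linarith

/-- The conditional variance is affine in the collision count, up to the small term of `t` itself,
so concentration of `sumChoose 2` makes it nearly constant. -/
theorem expect_collisionsAt_sq (hn : 0 < n) (t : ι) (J : ι → Fin n) :
    𝔼 x, collisionsAt t J x ^ 2 = (2 * (sumChoose 2 J - fiberCardErase t J (J t))
      + (Fintype.card ι - 1)) / n - (((Fintype.card ι : ℝ) - 1) / n) ^ 2 := by
  have hn' : (n : ℝ) ≠ 0 := by positivity
  have h : ∀ x, collisionsAt t J x ^ 2 = (fiberCardErase t J x : ℝ) ^ 2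
      - 2 * (((Fintype.card ι : ℝ) - 1) / n) * fiberCardErase t J x
      + (((Fintype.card ι : ℝ) - 1) / n) ^ 2 := fun x => by
    rw [collisionsAt]
    ring
  rw [Fintype.expect_eq_sum_div_card]
  simp only [h, sum_add_distrib, sum_sub_distrib, ← mul_sum, sum_fiberCardErase,
    sum_fiberCardErase_sq, sumChoose_two_eq t J, sum_const, card_univ, Fintype.card_fin,
    nsmul_eq_mul]
  field_simp
  ring

theorem expect_abs_sub_expect_collisionsAt_sq_le (hn : 0 < n) {k : ℕ}
    (hm : Fintype.card ι = k * n) (t : ι) :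
    𝔼 J : ι → Fin n, |𝔼 x, collisionsAt t J x ^ 2 - k|
      ≤ (26 * Real.exp (2 * k) + k + 2) / Real.sqrt n := by
  have : Nonempty (Fin n) := ⟨⟨0, hn⟩⟩
  have hn1 : (1 : ℝ) ≤ n := by exact_mod_cast hn
  have hm1 : (1 : ℝ) ≤ Fintype.card ι := by exact_mod_cast Fintype.card_pos_iff.mpr ⟨t⟩
  have hmk : (Fintype.card ι : ℝ) = k * n := by rw [hm]; push_cast; ring
  have hs : 0 < Real.sqrt n := Real.sqrt_pos.mpr (by linarith)
  have hsq : Real.sqrt n ^ 2 = n := Real.sq_sqrt (by linarith)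
  have hs1 : 1 ≤ Real.sqrt n := Real.one_le_sqrt.mpr hn1
  have hpt : ∀ J : ι → Fin n, |𝔼 x, collisionsAt t J x ^ 2 - k|
      ≤ (1 / Real.sqrt n / n) * collisions J ^ 2 + (2 / n) * fiberCardErase t J (J t)
        + (1 / Real.sqrt n + (k + 1) / n) := by
    intro J
    have heq : 𝔼 x, collisionsAt t J x ^ 2 - k = 2 / n * collisions J
        - 2 / n * fiberCardErase t J (J t) + ((Fintype.card ι : ℝ) - 1) / n ^ 2 - 1 / n := by
      rw [expect_collisionsAt_sq hn, collisions, hmk]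
      field_simp
      ring
    -- Arithmetic-geometric mean inequality with weight `√n`, the order of magnitude of
    -- `collisions`, so that the second moment suffices.
    have h1 : |2 / n * collisions J| ≤ (1 / Real.sqrt n / n) * collisions J ^ 2
        + 1 / Real.sqrt n := by
      rw [abs_mul, abs_of_pos (by positivity : (0 : ℝ) < 2 / n), ← sq_abs (collisions J)]
      have : (1 / Real.sqrt n / n) * |collisions J| ^ 2 + 1 / Real.sqrt n - 2 / n * |collisions J|
          = (|collisions J| - Real.sqrt n) ^ 2 / (Real.sqrt n * n) := by
        field_simp
        linear_combination -hsq
      have h2 : 0 ≤ (|collisions J| - Real.sqrt n) ^ 2 / (Real.sqrt n * n) := by positivity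
      linarith
    have h3 : 0 ≤ ((Fintype.card ι : ℝ) - 1) / n ^ 2 := div_nonneg (by linarith) (by positivity)
    have h4 : ((Fintype.card ι : ℝ) - 1) / n ^ 2 ≤ k / n := by
      rw [div_le_div_iff₀ (by positivity) (by positivity), hmk]
      nlinarith
    have h5 : (0 : ℝ) ≤ 2 / n * fiberCardErase t J (J t) := by positivity
    have h6 : (0 : ℝ) ≤ 1 / n := by positivity
    have h7 : ((k : ℝ) + 1) / n = k / n + 1 / n := by ring
    rw [heq, h7]
    rw [abs_le] at h1 ⊢
    constructor <;> linarith [h1.1, h1.2]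
  refine (expect_le_expect fun J _ => hpt J).trans ?_
  simp only [expect_add_distrib, ← mul_expect, expect_const univ_nonempty]
  have hA := expect_collisions_sq_le (ι := ι) hn hm
  have hB : 𝔼 J : ι → Fin n, (fiberCardErase t J (J t) : ℝ) ≤ Real.exp (2 * k) := by
    rw [← expect_update t]
    simp only [fiberCardErase_update, Function.update_self]
    simpa using expect_fiberCardErase_pow_le (ι := ι) hn hm t 1
  have hA' : 1 / Real.sqrt n / n * 𝔼 J : ι → Fin n, collisions J ^ 2
      ≤ 24 * Real.exp (2 * k) / Real.sqrt n := by
    calc _ ≤ 1 / Real.sqrt n / n * (n * (24 * Real.exp (2 * k))) := by gcongr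
      _ = _ := by field_simp
  have hinv : 1 / (n : ℝ) ≤ 1 / Real.sqrt n := by
    apply one_div_le_one_div_of_le hs
    nlinarith
  have hB' : 2 / (n : ℝ) * 𝔼 J : ι → Fin n, (fiberCardErase t J (J t) : ℝ)
      ≤ 2 * Real.exp (2 * k) / Real.sqrt n := by
    calc _ ≤ 2 * (1 / (n : ℝ)) * Real.exp (2 * k) := by
          rw [mul_one_div]; gcongr
      _ ≤ 2 * (1 / Real.sqrt n) * Real.exp (2 * k) := by gcongr
      _ = _ := by ring
  have hC : ((k : ℝ) + 1) / n ≤ (k + 1) / Real.sqrt n := by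
    rw [div_eq_mul_one_div, div_eq_mul_one_div _ (Real.sqrt n)]
    gcongr
  calc _ ≤ 24 * Real.exp (2 * k) / Real.sqrt n + 2 * Real.exp (2 * k) / Real.sqrt n
        + (1 / Real.sqrt n + (k + 1) / Real.sqrt n) := by gcongr
    _ = _ := by ring

end Resampling

end KOut

end

/-! ### Central limit theorem for the collisions by characteristic functions. -/

noncomputable section

namespace KOut

open Finset
open scoped BigOperators

theorem norm_exp_I_mul_sub_one_sub_le (u : ℝ) :
    ‖Complex.exp (Complex.I * u) - 1 - Complex.I * u‖ ≤ 3 * u ^ 2 := by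
  have hu : ‖Complex.I * (u : ℂ)‖ = |u| := by simp
  rcases le_total |u| 1 with h | h
  · have := Complex.norm_exp_sub_one_sub_id_le (hu.le.trans h)
    rw [hu, sq_abs] at this
    nlinarith [sq_nonneg u]
  · have h1 := norm_sub_le (Complex.exp (Complex.I * u) - 1) (Complex.I * u)
    have h2 : ‖Complex.exp (Complex.I * u) - 1‖ ≤ |u| := Real.norm_exp_I_mul_ofReal_sub_one_le
    rw [hu] at h1
    nlinarith [sq_abs u]

/-- Approximate Gaussian integration by parts in one variable, with `a` frozen. Taylor expansion
leaves three errors: the deviation of the variance from `k`, a third moment, and the cost of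
replacing `exp (i l y)` by `1` in the main term. -/
theorem norm_expect_mul_exp_sub_le {n k : ℕ} (y : Fin n → ℝ) (hy : 𝔼 x, y x = 0) (l a : ℝ) :
    ‖𝔼 x, (y x : ℂ) * Complex.exp (Complex.I * ((l * (a + y x) : ℝ) : ℂ))
        - Complex.I * l * k * 𝔼 x, Complex.exp (Complex.I * ((l * (a + y x) : ℝ) : ℂ))‖
      ≤ |l| * |𝔼 x, y x ^ 2 - k| + 3 * l ^ 2 * 𝔼 x, |y x| ^ 3 + k * l ^ 2 * 𝔼 x, |y x| := by
  rcases Nat.eq_zero_or_pos n with rfl | hn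
  · simp [Finset.univ_eq_empty]
    positivity
  have : Nonempty (Fin n) := ⟨⟨0, hn⟩⟩
  have hexp : ∀ x, Complex.exp (Complex.I * ((l * (a + y x) : ℝ) : ℂ))
      = Complex.exp (Complex.I * ((l * a : ℝ) : ℂ))
        * Complex.exp (Complex.I * ((l * y x : ℝ) : ℂ)) := by
    intro x
    rw [← Complex.exp_add]
    congr 1
    push_cast
    ring
  have hsplit : 𝔼 x, (y x : ℂ) * Complex.exp (Complex.I * ((l * (a + y x) : ℝ) : ℂ))
        - Complex.I * l * k * 𝔼 x, Complex.exp (Complex.I * ((l * (a + y x) : ℝ) : ℂ))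
      = Complex.exp (Complex.I * ((l * a : ℝ) : ℂ)) *
        (Complex.I * l * ((𝔼 x, y x ^ 2 - k : ℝ) : ℂ)
          + 𝔼 x, (y x : ℂ) * (Complex.exp (Complex.I * ((l * y x : ℝ) : ℂ)) - 1
              - Complex.I * ((l * y x : ℝ) : ℂ))
          - Complex.I * l * k * 𝔼 x, (Complex.exp (Complex.I * ((l * y x : ℝ) : ℂ)) - 1)) := by
    have h0 : 𝔼 x, (y x : ℂ) = 0 := by
      rw [← Complex.ofReal_expect, hy, Complex.ofReal_zero]
    have h1 : 𝔼 x, (y x : ℂ) * (Complex.exp (Complex.I * ((l * y x : ℝ) : ℂ)) - 1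
              - Complex.I * ((l * y x : ℝ) : ℂ))
        = 𝔼 x, (y x : ℂ) * Complex.exp (Complex.I * ((l * y x : ℝ) : ℂ))
          - 𝔼 x, (y x : ℂ) - Complex.I * l * 𝔼 x, (y x : ℂ) ^ 2 := by
      rw [mul_expect, ← expect_sub_distrib, ← expect_sub_distrib]
      refine expect_congr rfl fun x _ => ?_
      push_cast
      ring
    have h2 : 𝔼 x, (Complex.exp (Complex.I * ((l * y x : ℝ) : ℂ)) - 1)
        = 𝔼 x, Complex.exp (Complex.I * ((l * y x : ℝ) : ℂ)) - 1 := by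
      rw [expect_sub_distrib, expect_const univ_nonempty]
    have h3 : 𝔼 x, (y x : ℂ) * Complex.exp (Complex.I * ((l * (a + y x) : ℝ) : ℂ))
        = Complex.exp (Complex.I * ((l * a : ℝ) : ℂ)) *
          𝔼 x, (y x : ℂ) * Complex.exp (Complex.I * ((l * y x : ℝ) : ℂ)) := by
      rw [mul_expect]
      refine expect_congr rfl fun x _ => ?_
      rw [hexp]
      ring
    rw [h1, h2, h3, h0]
    simp only [hexp, ← mul_expect]
    rw [Complex.ofReal_sub, Complex.ofReal_expect]
    push_cast
    ring
  have hnorm : ∀ u : ℝ, ‖Complex.exp (Complex.I * (u : ℂ))‖ = 1 := fun u => by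
    rw [mul_comm]
    exact Complex.norm_exp_ofReal_mul_I u
  rw [hsplit, norm_mul, hnorm, one_mul]
  refine (norm_sub_le _ _).trans (add_le_add ((norm_add_le _ _).trans (add_le_add ?_ ?_)) ?_)
  · rw [norm_mul, Complex.norm_real]
    simp
  · refine (RCLike.norm_expect_le (K := ℂ)).trans ?_
    rw [mul_expect]
    refine expect_le_expect fun x _ => ?_
    rw [norm_mul, Complex.norm_real, Real.norm_eq_abs]
    calc _ ≤ |y x| * (3 * (l * y x) ^ 2) := by
          gcongr
          exact norm_exp_I_mul_sub_one_sub_le _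
      _ = _ := by rw [mul_pow, ← sq_abs (y x)]; ring
  · rw [norm_mul]
    have h1 : ‖Complex.I * l * (k : ℂ)‖ = |l| * k := by simp
    rw [h1]
    have h2 : ‖𝔼 x, (Complex.exp (Complex.I * ((l * y x : ℝ) : ℂ)) - 1)‖ ≤ |l| * 𝔼 x, |y x| := by
      refine (RCLike.norm_expect_le (K := ℂ)).trans ?_
      rw [mul_expect]
      refine expect_le_expect fun x _ => ?_
      rw [← abs_mul]
      exact Real.norm_exp_I_mul_ofReal_sub_one_le
    calc _ ≤ |l| * k * (|l| * 𝔼 x, |y x|) := by gcongr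
      _ = _ := by rw [← sq_abs l]; ring

section CharFun

variable {ι : Type*} [Fintype ι] [DecidableEq ι] {n : ℕ}

/-- The characteristic function of the centred number of colliding pairs. -/
def collisionCharFun (ι : Type*) [Fintype ι] [DecidableEq ι] (n : ℕ) (l : ℝ) : ℂ :=
  𝔼 J : ι → Fin n, Complex.exp (Complex.I * ((l * collisions J : ℝ) : ℂ))

/-- A constant in the error terms of the central limit theorem for the number of collisions. -/
def steinConst (k : ℕ) : ℝ :=
  (26 * Real.exp (2 * k) + k + 2) + 3 * (24 * Real.exp (2 * k) + 4 * k ^ 3)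
    + k * (Real.exp (2 * k) + k)

theorem steinConst_nonneg (k : ℕ) : 0 ≤ steinConst k := by
  unfold steinConst
  positivity

/-- With all arcs but `t` frozen, `collisions` is a constant plus `collisionsAt t J x`, which is
centred in `x`; the one-variable estimate is then averaged over the frozen arcs. -/
theorem norm_expect_collisionsAt_mul_exp_sub_le (hn : 0 < n) {k : ℕ}
    (hm : Fintype.card ι = k * n) (t : ι) (l : ℝ) :
    ‖𝔼 J : ι → Fin n, (collisionsAt t J (J t) : ℂ)
          * Complex.exp (Complex.I * ((l * collisions J : ℝ) : ℂ))
        - Complex.I * l * k * collisionCharFun ι n l‖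
      ≤ steinConst k * (|l| / Real.sqrt n + l ^ 2) := by
  have : Nonempty (Fin n) := ⟨⟨0, hn⟩⟩
  have hn1 : (1 : ℝ) ≤ n := by exact_mod_cast hn
  have hs : 0 < Real.sqrt n := Real.sqrt_pos.mpr (by linarith)
  rw [collisionCharFun, ← expect_update t, ← expect_update t (fun J : ι → Fin n =>
    Complex.exp (Complex.I * ((l * collisions J : ℝ) : ℂ))), mul_expect, ← expect_sub_distrib]
  simp only [collisionsAt_update, Function.update_self, collisions_update]
  refine (RCLike.norm_expect_le (K := ℂ)).trans ((expect_le_expect fun J _ =>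
    norm_expect_mul_exp_sub_le (k := k) (collisionsAt t J) (expect_collisionsAt hn t J) l
    (collisions J - collisionsAt t J (J t))).trans ?_)
  simp only [expect_add_distrib, ← mul_expect]
  have h1 := expect_abs_sub_expect_collisionsAt_sq_le hn hm t
  have h2 := expect_abs_collisionsAt_pow_three_le hn hm t
  have h3 := expect_abs_collisionsAt_le hn hm t
  calc _ ≤ |l| * ((26 * Real.exp (2 * k) + k + 2) / Real.sqrt n)
        + 3 * l ^ 2 * (24 * Real.exp (2 * k) + 4 * k ^ 3)
        + k * l ^ 2 * (Real.exp (2 * k) + k) := by gcongr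
    _ ≤ _ := by
      have e : steinConst k * (|l| / Real.sqrt n + l ^ 2)
        - (|l| * ((26 * Real.exp (2 * k) + k + 2) / Real.sqrt n)
        + 3 * l ^ 2 * (24 * Real.exp (2 * k) + 4 * k ^ 3)
        + k * l ^ 2 * (Real.exp (2 * k) + k))
        = (3 * (24 * Real.exp (2 * k) + 4 * k ^ 3) + k * (Real.exp (2 * k) + k))
            * (|l| / Real.sqrt n) + (26 * Real.exp (2 * k) + k + 2) * l ^ 2 := by
        unfold steinConst
        ring
      rw [← sub_nonneg, e]
      positivity

theorem hasDerivAt_collisionCharFun (l : ℝ) :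
    HasDerivAt (collisionCharFun ι n) (𝔼 J : ι → Fin n, Complex.I * (collisions J : ℂ)
      * Complex.exp (Complex.I * ((l * collisions J : ℝ) : ℂ))) l := by
  have h : ∀ J : ι → Fin n, HasDerivAt
      (fun l : ℝ => Complex.exp (Complex.I * ((l * collisions J : ℝ) : ℂ)))
      (Complex.I * (collisions J : ℂ)
        * Complex.exp (Complex.I * ((l * collisions J : ℝ) : ℂ))) l := by
    intro J
    have h1 : HasDerivAt (fun l : ℝ => ((l * collisions J : ℝ) : ℂ)) (collisions J : ℂ) l := by
      have := (hasDerivAt_mul_const (x := l) (collisions J)).ofReal_comp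
      exact this
    have := (h1.const_mul Complex.I).cexp
    rwa [mul_comm] at this
  unfold collisionCharFun
  simp only [Fintype.expect_eq_sum_div_card]
  exact (HasDerivAt.fun_sum fun J _ => h J).div_const _

/-- The approximate differential equation `φ' = -(k² n / 2) l φ`: `collisions` is half a sum over `k
* n` arcs, each contributing about `i l k φ`. -/
theorem norm_deriv_collisionCharFun_add_le (hn : 0 < n) {k : ℕ} (hm : Fintype.card ι = k * n)
    (l : ℝ) :
    ‖𝔼 J : ι → Fin n, Complex.I * (collisions J : ℂ)
        * Complex.exp (Complex.I * ((l * collisions J : ℝ) : ℂ))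
        + (k ^ 2 * n / 2 : ℝ) * l * collisionCharFun ι n l‖
      ≤ (k * n / 2) * (steinConst k * (|l| / Real.sqrt n + l ^ 2)) := by
  have hc : ∀ J : ι → Fin n, Complex.I * (collisions J : ℂ)
        * Complex.exp (Complex.I * ((l * collisions J : ℝ) : ℂ))
      = ∑ t, Complex.I / 2 * ((collisionsAt t J (J t) : ℂ)
          * Complex.exp (Complex.I * ((l * collisions J : ℝ) : ℂ))) := by
    intro J
    rw [← mul_sum, ← sum_mul, ← Complex.ofReal_sum, ← two_mul_collisions]
    push_cast
    ring
  have hsum : (k ^ 2 * n / 2 : ℝ) * l * collisionCharFun ι n l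
      = ∑ _t : ι, Complex.I / 2 * (-(Complex.I * l * k * collisionCharFun ι n l)) := by
    rw [sum_const, card_univ, hm, nsmul_eq_mul]
    push_cast
    linear_combination ((k ^ 2 * n * l / 2 * collisionCharFun ι n l : ℂ)) * Complex.I_sq
  simp only [hc]
  rw [expect_sum_comm, hsum, ← sum_add_distrib]
  simp only [← mul_expect, ← mul_add, ← sub_eq_add_neg]
  refine (norm_sum_le _ _).trans ((sum_le_sum (g := fun _ =>
    (1 / 2) * (steinConst k * (|l| / Real.sqrt n + l ^ 2))) fun t _ => ?_).trans_eq ?_)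
  · rw [norm_mul]
    refine mul_le_mul (by simp) (norm_expect_collisionsAt_mul_exp_sub_le hn hm t l)
      (norm_nonneg _) (by norm_num)
  · rw [sum_const, card_univ, hm, nsmul_eq_mul]
    push_cast
    ring

/-- The exponential is the integrating factor of that equation at scale `θ / √n`. The product equals
`1` at `0` and has derivative `O(1 / √n)` on `[-|θ|, |θ|]`. -/
theorem norm_collisionCharFun_mul_exp_sub_one_le (hn : 0 < n) {k : ℕ}
    (hm : Fintype.card ι = k * n) (θ : ℝ) :
    ‖collisionCharFun ι n (θ / Real.sqrt n) * Complex.exp ((k ^ 2 * θ ^ 2 / 4 : ℝ) : ℂ) - 1‖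
      ≤ (k / 2 * steinConst k * (|θ| + θ ^ 2) * Real.exp (k ^ 2 * θ ^ 2 / 4) * |θ|)
        / Real.sqrt n := by
  have : Nonempty (Fin n) := ⟨⟨0, hn⟩⟩
  have hn1 : (1 : ℝ) ≤ n := by exact_mod_cast hn
  have hs : 0 < Real.sqrt n := Real.sqrt_pos.mpr (by linarith)
  have hsq : Real.sqrt n ^ 2 = n := Real.sq_sqrt (by linarith)
  set s := Real.sqrt n with hs_def
  set D : ℝ → ℂ := fun l => 𝔼 J : ι → Fin n, Complex.I * (collisions J : ℂ)
        * Complex.exp (Complex.I * ((l * collisions J : ℝ) : ℂ)) with hD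
  set f : ℝ → ℂ := fun u => collisionCharFun ι n (u / s) *
    Complex.exp ((k ^ 2 * u ^ 2 / 4 : ℝ) : ℂ) with hf
  have hderiv : ∀ u : ℝ, HasDerivAt f ((D (u / s) + (k ^ 2 * n / 2 : ℝ) * ((u / s : ℝ) : ℂ)
      * collisionCharFun ι n (u / s)) / s * Complex.exp ((k ^ 2 * u ^ 2 / 4 : ℝ) : ℂ)) u := by
    intro u
    have h1 : HasDerivAt (fun u : ℝ => collisionCharFun ι n (u / s)) ((1 / s : ℝ) • D (u / s)) u :=
      HasDerivAt.scomp (g₁ := collisionCharFun ι n) u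
        (hasDerivAt_collisionCharFun (u / s)) ((hasDerivAt_id u).div_const s)
    have h2 : HasDerivAt (fun u : ℝ => ((k ^ 2 * u ^ 2 / 4 : ℝ) : ℂ))
        ((k ^ 2 * u / 2 : ℝ) : ℂ) u := by
      have : HasDerivAt (fun u : ℝ => (k ^ 2 * u ^ 2 / 4 : ℝ)) (k ^ 2 * u / 2 : ℝ) u := by
        refine (((hasDerivAt_pow 2 u).const_mul ((k : ℝ) ^ 2)).div_const 4).congr_deriv ?_
        simp
        ring
      exact this.ofReal_comp
    refine (h1.fun_mul h2.cexp).congr_deriv ?_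
    have hsC : (s : ℂ) ≠ 0 := by exact_mod_cast hs.ne'
    have hsqC : (s : ℂ) ^ 2 = n := by exact_mod_cast hsq
    rw [Complex.real_smul]
    push_cast
    rw [← hsqC]
    field_simp
  have hbound : ∀ u ∈ Set.Icc (-|θ|) |θ|, ‖(D (u / s) + (k ^ 2 * n / 2 : ℝ) * ((u / s : ℝ) : ℂ)
      * collisionCharFun ι n (u / s)) / s * Complex.exp ((k ^ 2 * u ^ 2 / 4 : ℝ) : ℂ)‖
      ≤ k / 2 * steinConst k * (|θ| + θ ^ 2) * Real.exp (k ^ 2 * θ ^ 2 / 4) / s := by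
    intro u hu
    have hu' : |u| ≤ |θ| := abs_le.mpr hu
    have husq : u ^ 2 ≤ θ ^ 2 := sq_le_sq.mpr hu'
    have h := norm_deriv_collisionCharFun_add_le (ι := ι) hn hm (u / s)
    have hc := steinConst_nonneg k
    rw [norm_mul, norm_div, Complex.norm_exp, Complex.ofReal_re, Complex.norm_real,
      Real.norm_eq_abs, abs_of_pos hs]
    calc _ ≤ (k * n / 2) * (steinConst k * (|u / s| / s + (u / s) ^ 2)) / s
          * Real.exp (k ^ 2 * u ^ 2 / 4) := by gcongr
      _ = k / 2 * steinConst k * (|u| + u ^ 2) * Real.exp (k ^ 2 * u ^ 2 / 4) / s := by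
          rw [abs_div, abs_of_pos hs, ← hsq]
          field_simp
      _ ≤ _ := by gcongr
  have hmv := (convex_Icc (-|θ|) |θ|).norm_image_sub_le_of_norm_hasDerivWithin_le
    (f := f) (fun u _ => (hderiv u).hasDerivWithinAt) hbound (x := 0) (y := θ)
    (by simp) (abs_le.mp le_rfl)
  have hf0 : f 0 = 1 := by
    simp [hf, collisionCharFun, expect_const univ_nonempty]
  rw [hf0, sub_zero, Real.norm_eq_abs] at hmv
  refine hmv.trans_eq ?_
  ring

end CharFun

end KOut

end

/-! ### Expansion of the log-likelihood ratio. -/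

noncomputable section

namespace KOut

open Finset
open scoped BigOperators

theorem abs_log_one_add_sub_le {x : ℝ} (hx : 0 ≤ x) :
    |Real.log (1 + x) - x + x ^ 2 / 2| ≤ x ^ 3 := by
  have hlow : x - x ^ 2 / 2 ≤ Real.log (1 + x) := by
    refine le_trans ?_ (Real.le_log_one_add_of_nonneg hx)
    rw [le_div_iff₀ (by linarith)]
    nlinarith [pow_nonneg hx 3]
  have hup : Real.log (1 + x) ≤ x - x ^ 2 / 2 + x ^ 3 / 3 := by
    have hd : ∀ y ∈ Set.Ici (0 : ℝ), HasDerivAt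
        (fun y : ℝ => y - y ^ 2 / 2 + y ^ 3 / 3 - Real.log (1 + y)) (y ^ 3 / (1 + y)) y := by
      intro y hy
      have hy : 0 ≤ y := hy
      have hne : 1 + y ≠ 0 := by positivity
      refine ((((hasDerivAt_id y).sub ((hasDerivAt_pow 2 y).div_const 2)).add
        ((hasDerivAt_pow 3 y).div_const 3)).sub
        (((hasDerivAt_id y).const_add 1).log hne)).congr_deriv ?_
      simp only [id]
      field_simp
      push_cast
      ring
    have hmono : MonotoneOn (fun y : ℝ => y - y ^ 2 / 2 + y ^ 3 / 3 - Real.log (1 + y))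
        (Set.Ici 0) := by
      refine monotoneOn_of_deriv_nonneg (convex_Ici 0)
        (fun y hy => (hd y hy).continuousAt.continuousWithinAt)
        (fun y hy => (hd y (interior_subset hy)).differentiableAt.differentiableWithinAt)
        fun y hy => ?_
      have hy0 : 0 ≤ y := interior_subset hy
      rw [(hd y hy0).deriv]
      positivity
    have := hmono Set.self_mem_Ici hx hx
    norm_num at this
    linarith
  have h3 : 0 ≤ x ^ 3 := pow_nonneg hx 3
  rw [abs_le]
  constructor <;> linarith

theorem sum_range_cast (d : ℕ) : ∑ i ∈ range d, (i : ℝ) = d.choose 2 := by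
  rw [← Nat.cast_sum, Finset.sum_range_id, Nat.choose_two_right]

theorem sum_range_cast_sq (d : ℕ) :
    ∑ i ∈ range d, (i : ℝ) ^ 2 = 2 * d.choose 3 + d.choose 2 := by
  induction d with
  | zero => simp
  | succ d ih =>
    rw [sum_range_succ, ih, Nat.choose_succ_succ' d 2, Nat.choose_succ_succ' d 1,
      Nat.choose_one_right]
    push_cast
    rw [Nat.cast_choose_two]
    ring

/-- The logarithm of the rising factorial, normalized by the power. -/
def logRising (a : ℝ) (d : ℕ) : ℝ := ∑ i ∈ range d, Real.log (1 + i / a)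

theorem risingFactorial_eq {a : ℝ} (ha : 0 < a) (d : ℕ) :
    risingFactorial a d = a ^ d * Real.exp (logRising a d) := by
  rw [risingFactorial, logRising, Real.exp_sum, ← card_range d, ← prod_const, card_range,
    ← prod_mul_distrib]
  refine prod_congr rfl fun i _ => ?_
  rw [Real.exp_log (by positivity)]
  field_simp

/-- Power sums are written with binomial coefficients because the binomial moments of the fibre
sizes are explicit. -/
theorem abs_logRising_sub_le {a : ℝ} (ha : 0 < a) (d : ℕ) :
    |logRising a d - d.choose 2 / a + (2 * d.choose 3 + d.choose 2) / (2 * a ^ 2)|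
      ≤ d ^ 4 / a ^ 3 := by
  have h : logRising a d - d.choose 2 / a + (2 * d.choose 3 + d.choose 2) / (2 * a ^ 2)
      = ∑ i ∈ range d, (Real.log (1 + i / a) - i / a + (i / a) ^ 2 / 2) := by
    rw [← sum_range_cast_sq, ← sum_range_cast, logRising, sum_add_distrib, sum_sub_distrib,
      sum_div, sum_div]
    congr 1
    refine sum_congr rfl fun i _ => ?_
    field_simp
  rw [h]
  refine (abs_sum_le_sum_abs _ _).trans ((sum_le_sum (g := fun _ => (d : ℝ) ^ 3 / a ^ 3)
    fun i hi => ?_).trans_eq ?_)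
  · refine (abs_log_one_add_sub_le (by positivity)).trans ?_
    rw [div_pow]
    have : (i : ℝ) ≤ d := by exact_mod_cast (mem_range.mp hi).le
    gcongr
  · rw [sum_const, card_range, nsmul_eq_mul]
    ring

section Likelihood

variable {ι : Type*} [Fintype ι] {n : ℕ}

/-- The logarithm of the likelihood ratio of the preferential attachment mapping with respect to
the uniform mapping. -/
def logRatio (α : ℝ) (J : ι → Fin n) : ℝ :=
  ∑ j, logRising α (fiberCard J j) - logRising (α * n) (Fintype.card ι)

/-- The powers of `α` cancel because the fibre sizes sum to the number of arcs. -/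
theorem exp_logRatio {α : ℝ} (hα : 0 < α) (hn : 0 < n) (J : ι → Fin n) :
    Real.exp (logRatio α J) = n ^ Fintype.card ι *
      ((∏ j, risingFactorial α (fiberCard J j)) / risingFactorial (α * n) (Fintype.card ι)) := by
  have hn' : (0 : ℝ) < n := by positivity
  simp only [risingFactorial_eq hα, risingFactorial_eq (mul_pos hα hn'), prod_mul_distrib,
    prod_pow_eq_pow_sum, sum_fiberCard, logRatio, Real.exp_sub, Real.exp_sum, mul_pow]
  have := (Real.exp_pos (logRising (α * n) (Fintype.card ι))).ne'
  field_simp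

theorem expect_abs_le_of_expect_sq_le {Ω : Type*} [Fintype Ω] [Nonempty Ω] (f : Ω → ℝ) {N V : ℝ}
    (hN : 0 < N) (h : 𝔼 x, f x ^ 2 ≤ N * V) : 𝔼 x, |f x| ≤ Real.sqrt N * ((V + 1) / 2) := by
  have hs : 0 < Real.sqrt N := Real.sqrt_pos.mpr hN
  have hsq : Real.sqrt N ^ 2 = N := Real.sq_sqrt hN.le
  have hpt : ∀ x, |f x| ≤ (1 / (2 * Real.sqrt N)) * f x ^ 2 + Real.sqrt N / 2 := by
    intro x
    have e : (1 / (2 * Real.sqrt N)) * f x ^ 2 + Real.sqrt N / 2 - |f x|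
        = (|f x| - Real.sqrt N) ^ 2 / (2 * Real.sqrt N) := by
      rw [← sq_abs (f x)]
      field_simp
      ring
    have : 0 ≤ (|f x| - Real.sqrt N) ^ 2 / (2 * Real.sqrt N) := by positivity
    linarith
  refine (expect_le_expect fun x _ => hpt x).trans ?_
  rw [expect_add_distrib, ← mul_expect, expect_const univ_nonempty]
  calc _ ≤ (1 / (2 * Real.sqrt N)) * (N * V) + Real.sqrt N / 2 := by gcongr
    _ = _ := by
      rw [← hsq, Real.sqrt_sq hs.le]
      field_simp

/-- A constant in the error term of the approximation of the likelihood ratio. -/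
def likelihoodConst (k : ℕ) (β : ℝ) : ℝ :=
  (1000 * Real.exp (2 * k) + k + k ^ 2 + 2) / β ^ 2 + (24 * Real.exp (2 * k) + k ^ 4) / β ^ 3

theorem expect_abs_logRatio_sub_le [DecidableEq ι] (hn : 0 < n) {k : ℕ}
    (hm : Fintype.card ι = k * n) {β : ℝ} (hβ : 0 < β) :
    𝔼 J : ι → Fin n, |logRatio (β * Real.sqrt n) J
        - (collisions J / (β * Real.sqrt n) - k ^ 2 / (4 * β ^ 2))|
      ≤ likelihoodConst k β / Real.sqrt n := by
  have : Nonempty (Fin n) := ⟨⟨0, hn⟩⟩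
  have hn0 : (0 : ℝ) < n := by exact_mod_cast hn
  have hn1 : (1 : ℝ) ≤ n := by exact_mod_cast hn
  have hs : 0 < Real.sqrt n := Real.sqrt_pos.mpr (by linarith)
  have hsq : Real.sqrt n ^ 2 = n := Real.sq_sqrt (by linarith)
  have hs1 : 1 ≤ Real.sqrt n := Real.one_le_sqrt.mpr hn1
  have hmk : (Fintype.card ι : ℝ) = k * n := by rw [hm]; push_cast; ring
  have hmn : (Fintype.card ι : ℝ) / n = k := by rw [hmk]; field_simp
  set s := Real.sqrt n with hs_def
  set α := β * s with hα_def
  have hα : 0 < α := mul_pos hβ hs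
  have hα2 : α ^ 2 = β ^ 2 * n := by rw [hα_def, mul_pow, hsq]
  set m := Fintype.card ι with hm_def
  set E := Real.exp (2 * k) with hE
  have hE1 : 1 ≤ E := Real.one_le_exp (by positivity)
  set p : ℕ → ℝ := fun a => n * (m.choose a / (n : ℝ) ^ a) with hp
  have hdev : ∀ a : ℕ, 𝔼 J : ι → Fin n, |sumChoose a J - p a|
      ≤ s * (((2 * a).factorial * E + 1) / 2) := by
    intro a
    refine expect_abs_le_of_expect_sq_le (fun J => sumChoose a J - p a) hn0 ?_
    have := expect_sumChoose_sub_sq_le (ι := ι) hn a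
    rwa [← hm_def, hmn] at this
  have hpt : ∀ J : ι → Fin n, |logRatio α J - (collisions J / α - k ^ 2 / (4 * β ^ 2))|
      ≤ (1 / (β ^ 2 * n)) * |sumChoose 3 J - p 3| + (1 / (2 * (β ^ 2 * n))) * |sumChoose 2 J - p 2|
        + (k + k ^ 2) / (4 * β ^ 2 * n) + ∑ j, (fiberCard J j : ℝ) ^ 4 / α ^ 3
        + (m : ℝ) ^ 4 / (α * n) ^ 3 := by
    intro J
    set e : Fin n → ℝ := fun j => logRising α (fiberCard J j) - (fiberCard J j).choose 2 / α
      + (2 * (fiberCard J j).choose 3 + (fiberCard J j).choose 2) / (2 * α ^ 2) with he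
    set e' : ℝ := logRising (α * n) m - m.choose 2 / (α * n)
      + (2 * m.choose 3 + m.choose 2) / (2 * (α * n) ^ 2) with he'
    have h1 : |∑ j, e j| ≤ ∑ j, (fiberCard J j : ℝ) ^ 4 / α ^ 3 :=
      (abs_sum_le_sum_abs _ _).trans (sum_le_sum fun j _ => abs_logRising_sub_le hα _)
    have h2 : |e'| ≤ (m : ℝ) ^ 4 / (α * n) ^ 3 := abs_logRising_sub_le (mul_pos hα hn0) _
    have hsum : ∑ j, e j = ∑ j, logRising α (fiberCard J j) - sumChoose 2 J / α
        + (2 * sumChoose 3 J + sumChoose 2 J) / (2 * α ^ 2) := by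
      simp only [he, sumChoose, sum_add_distrib, sum_sub_distrib, ← sum_div, ← mul_sum]
    -- The centrings absorb the normalizing term: first-order terms match exactly, `p 3` cancels the
    -- cubic part of the denominator, and `p 2` yields `k² / (4β²)` up to `O(1 / n)`.
    have key : logRatio α J - (collisions J / α - k ^ 2 / (4 * β ^ 2))
        = -((1 / (β ^ 2 * n)) * (sumChoose 3 J - p 3))
          - (1 / (2 * (β ^ 2 * n))) * (sumChoose 2 J - p 2)
          + (k + k * (k * n - 1) / n) / (4 * β ^ 2 * n) + ∑ j, e j - e' := by
      rw [hsum, he', hα2, mul_pow, hα2]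
      simp only [hp, logRatio, collisions, ← hm_def]
      rw [Nat.cast_choose_two, hmk]
      field_simp
      ring
    have h3 : |(k + k * (k * n - 1) / n) / (4 * β ^ 2 * n)| ≤ (k + k ^ 2) / (4 * β ^ 2 * n) := by
      have hk : (0 : ℝ) ≤ k + k * (k * n - 1) / n := by
        have : (k : ℝ) + k * (k * n - 1) / n = k ^ 2 + k * ((n - 1) / n) := by field_simp; ring
        rw [this]
        have : 0 ≤ ((n : ℝ) - 1) / n := div_nonneg (by linarith) hn0.le
        positivity
      have hk2 : (k : ℝ) + k * (k * n - 1) / n ≤ k + k ^ 2 := by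
        have : (k : ℝ) * (k * n - 1) / n = k ^ 2 - k / n := by field_simp
        rw [this]
        have : (0 : ℝ) ≤ k / n := by positivity
        linarith
      rw [abs_of_nonneg (by positivity)]
      gcongr
    rw [key]
    refine (abs_sub _ _).trans ?_
    refine add_le_add ((abs_add_le _ _).trans (add_le_add ((abs_add_le _ _).trans
      (add_le_add ((abs_sub _ _).trans (add_le_add ?_ ?_)) h3)) h1)) h2
    · rw [abs_neg, abs_mul, abs_of_pos (by positivity)]
    · rw [abs_mul, abs_of_pos (by positivity)]
  refine (expect_le_expect fun J _ => hpt J).trans ?_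
  simp only [expect_add_distrib, ← mul_expect, expect_const univ_nonempty]
  have h4 : 𝔼 J : ι → Fin n, ∑ j, (fiberCard J j : ℝ) ^ 4 / α ^ 3 ≤ n * (24 * E / α ^ 3) := by
    rw [expect_sum_comm]
    refine (sum_le_sum (g := fun _ => 24 * E / α ^ 3) fun j _ => ?_).trans_eq (by simp)
    rw [← expect_div]
    gcongr
    have := expect_fiberCard_pow_le (ι := ι) hn j 4
    rw [← hm_def, hmn] at this
    simpa [Nat.factorial] using this
  have hd3 := hdev 3
  have hd2 := hdev 2
  norm_num [Nat.factorial] at hd3 hd2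
  have hα3 : α ^ 3 = β ^ 3 * n * s := by
    rw [hα_def, ← hsq]
    ring
  have hm4 : (m : ℝ) ^ 4 / (α * n) ^ 3 ≤ k ^ 4 / β ^ 3 / s := by
    rw [mul_pow, hα3, hmk]
    have : ((k : ℝ) * n) ^ 4 / (β ^ 3 * n * s * n ^ 3) = k ^ 4 / β ^ 3 / s := by
      field_simp
    exact this.le
  have hinv : 1 / (n : ℝ) ≤ 1 / s := by
    apply one_div_le_one_div_of_le hs
    nlinarith
  have h5 : ((k : ℝ) + k ^ 2) / (4 * β ^ 2 * n) ≤ (k + k ^ 2) / β ^ 2 / s := by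
    calc ((k : ℝ) + k ^ 2) / (4 * β ^ 2 * n) = (k + k ^ 2) / β ^ 2 * (1 / n) * (1 / 4) := by
          field_simp
      _ ≤ (k + k ^ 2) / β ^ 2 * (1 / s) * 1 := by gcongr; norm_num
      _ = _ := by ring
  calc _ ≤ (1 / (β ^ 2 * n)) * (s * ((720 * E + 1) / 2))
        + (1 / (2 * (β ^ 2 * n))) * (s * ((24 * E + 1) / 2)) + (k + k ^ 2) / β ^ 2 / s
        + n * (24 * E / α ^ 3) + k ^ 4 / β ^ 3 / s := by gcongr
    _ = ((366 * E + 3 / 4) + k + k ^ 2) / β ^ 2 / s + (24 * E + k ^ 4) / β ^ 3 / s := by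
      rw [hα3, ← hsq]
      field_simp
      ring
    _ ≤ _ := by
      rw [likelihoodConst, add_div _ _ s, ← hE]
      refine add_le_add ?_ le_rfl
      gcongr ?_ / β ^ 2 / s
      linarith

end Likelihood

end KOut

end

/-! ### Total variation through likelihood ratios, and Gaussian integrals. -/

noncomputable section

namespace KOut

open Finset MeasureTheory ProbabilityTheory Filter
open scoped BigOperators Topology

/-- Truncation makes the exponential Lipschitz, so that approximation of `Λ` in mean is enough. -/
theorem abs_exp_min_sub_exp_min_le (a b c : ℝ) :
    |Real.exp (min a c) - Real.exp (min b c)| ≤ Real.exp c * |a - b| := by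
  have h : ∀ x y : ℝ, x ≤ c → Real.exp x - Real.exp y ≤ Real.exp c * |x - y| := by
    intro x y hx
    have h1 : Real.exp x - Real.exp y = Real.exp x * (1 - Real.exp (-(x - y))) := by
      rw [mul_sub, ← Real.exp_add]
      simp
    have h2 : 1 - Real.exp (-(x - y)) ≤ |x - y| := by
      linarith [Real.add_one_le_exp (-(x - y)), le_abs_self (x - y)]
    rw [h1]
    calc _ ≤ Real.exp x * |x - y| := by gcongr
      _ ≤ _ := by gcongr
  have h1 := h (min a c) (min b c) (min_le_right _ _)
  have h2 := h (min b c) (min a c) (min_le_right _ _)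
  have h3 : |min a c - min b c| ≤ |a - b| := by
    simpa using abs_min_sub_min_le_max a c b c
  have h4 : Real.exp c * |min a c - min b c| ≤ Real.exp c * |a - b| := by gcongr
  rw [abs_sub_comm] at h2
  rw [abs_le]
  constructor <;> linarith

section TotalVariation

variable {Ω Ξ : Type*} [Fintype Ω] [Nonempty Ω]

theorem toReal_toOuterMeasure_map (p : PMF Ω) {w : Ω → ℝ} (hw : ∀ x, 0 ≤ w x)
    (hp : ∀ x, p x = ENNReal.ofReal (w x / Fintype.card Ω)) (X : Ω → Ξ) (A : Set Ξ)
    [DecidablePred (· ∈ A)] :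
    ((p.map X).toOuterMeasure A).toReal = 𝔼 x, if X x ∈ A then w x else 0 := by
  rw [PMF.toOuterMeasure_map_apply, PMF.toOuterMeasure_apply_fintype,
    Fintype.expect_eq_sum_div_card, ENNReal.toReal_sum, sum_div]
  · refine sum_congr rfl fun x _ => ?_
    by_cases hx : X x ∈ A
    · rw [Set.indicator_of_mem (by exact hx), if_pos hx, hp,
        ENNReal.toReal_ofReal (div_nonneg (hw x) (by positivity))]
    · rw [Set.indicator_of_notMem (by exact hx), if_neg hx]
      simp
  · intro x _
    by_cases hx : X x ∈ A
    · rw [Set.indicator_of_mem (by exact hx)]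
      exact p.apply_ne_top x
    · rw [Set.indicator_of_notMem (by exact hx)]
      simp

variable {p q : PMF Ω} {Λ : Ω → ℝ}

theorem expect_exp_eq_one (hp : ∀ x, p x = ENNReal.ofReal (Real.exp (Λ x) / Fintype.card Ω)) :
    𝔼 x, Real.exp (Λ x) = 1 := by
  have h := toReal_toOuterMeasure_map p (fun x => (Real.exp_pos (Λ x)).le) hp id Set.univ
  rw [(PMF.toOuterMeasure_apply_eq_one_iff _ _).mpr (Set.subset_univ _)] at h
  simpa using h.symm

/-- The integrand is `(1 - e^Λ)⁺`, which dominates `1 - e^Λ` on any event; the opposite sign is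
reduced to this by `E e^Λ = 1`. -/
theorem abs_toOuterMeasure_sub_le
    (hp : ∀ x, p x = ENNReal.ofReal (Real.exp (Λ x) / Fintype.card Ω))
    (hq : ∀ x, q x = ENNReal.ofReal (1 / Fintype.card Ω)) (X : Ω → Ξ) (A : Set Ξ) :
    |((p.map X).toOuterMeasure A).toReal - ((q.map X).toOuterMeasure A).toReal|
      ≤ 𝔼 x, (1 - Real.exp (min (Λ x) 0)) := by
  classical
  rw [toReal_toOuterMeasure_map p (fun x => (Real.exp_pos (Λ x)).le) hp,
    toReal_toOuterMeasure_map q (w := fun _ => 1) (fun _ => zero_le_one) hq,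
    ← expect_sub_distrib]
  have h1 := expect_exp_eq_one hp
  have hmin : ∀ x, Real.exp (min (Λ x) 0) = min (Real.exp (Λ x)) 1 := fun x => by
    rw [Real.exp_monotone.map_min, Real.exp_zero]
  have h2 : 𝔼 x, (Real.exp (Λ x) - 1) = 0 := by
    rw [expect_sub_distrib, h1, expect_const univ_nonempty, sub_self]
  rw [abs_le]
  constructor
  · rw [neg_le, ← expect_neg_distrib]
    refine expect_le_expect fun x _ => ?_
    rw [hmin]
    rcases min_cases (Real.exp (Λ x)) 1 with ⟨h, h'⟩ | ⟨h, h'⟩ <;> rw [h] <;> split_ifs <;> linarith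
  · refine le_of_le_of_eq (b := 𝔼 x, (1 - Real.exp (min (Λ x) 0)) + 𝔼 x, (Real.exp (Λ x) - 1)) ?_
      (by rw [h2, add_zero])
    rw [← expect_add_distrib]
    refine expect_le_expect fun x _ => ?_
    rw [hmin]
    rcases min_cases (Real.exp (Λ x)) 1 with ⟨h, h'⟩ | ⟨h, h'⟩ <;> rw [h] <;> split_ifs <;> linarith

theorem tvDist_map_le (hp : ∀ x, p x = ENNReal.ofReal (Real.exp (Λ x) / Fintype.card Ω))
    (hq : ∀ x, q x = ENNReal.ofReal (1 / Fintype.card Ω)) (X : Ω → Ξ) (Y : Ω → ℝ) :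
    tvDist (p.map X) (q.map X)
      ≤ 𝔼 x, (1 - Real.exp (min (Y x) 0)) + 𝔼 x, |Λ x - Y x| := by
  refine (ciSup_le fun A => abs_toOuterMeasure_sub_le hp hq X A).trans ?_
  rw [← expect_add_distrib]
  refine expect_le_expect fun x _ => ?_
  have := neg_abs_le (Real.exp (min (Λ x) 0) - Real.exp (min (Y x) 0))
  have h := abs_exp_min_sub_exp_min_le (Λ x) (Y x) 0
  rw [Real.exp_zero, one_mul] at h
  linarith

/-- On the event `g < 0`, the difference of probabilities is rewritten through `E e^Λ = 1` as the
integral of `e^Λ - 1` over the complement. There only a lower bound on `e^Λ` is needed, and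
truncation at `c` provides one without any control of large `Λ`. -/
theorem le_tvDist_map (hp : ∀ x, p x = ENNReal.ofReal (Real.exp (Λ x) / Fintype.card Ω))
    (hq : ∀ x, q x = ENNReal.ofReal (1 / Fintype.card Ω)) (X : Ω → Ξ) (g : Ξ → ℝ) {c : ℝ}
    (hc : 0 ≤ c) :
    𝔼 x, (Real.exp (max (min (g (X x)) c) 0) - 1) - Real.exp c * 𝔼 x, |Λ x - g (X x)|
      ≤ tvDist (p.map X) (q.map X) := by
  classical
  have hb : BddAbove (Set.range fun A : Set Ξ => |((p.map X).toOuterMeasure A).toReal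
      - ((q.map X).toOuterMeasure A).toReal|) :=
    ⟨_, by rintro _ ⟨A, rfl⟩; exact abs_toOuterMeasure_sub_le hp hq X A⟩
  refine le_trans ?_ (le_ciSup hb {x | g x < 0})
  refine le_trans ?_ (neg_le_abs _)
  rw [toReal_toOuterMeasure_map p (fun x => (Real.exp_pos (Λ x)).le) hp,
    toReal_toOuterMeasure_map q (w := fun _ => 1) (fun _ => zero_le_one) hq,
    ← expect_sub_distrib, ← expect_neg_distrib, mul_expect, ← expect_sub_distrib]
  have h1 := expect_exp_eq_one hp
  have h2 : 𝔼 x, (Real.exp (Λ x) - 1) = 0 := by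
    rw [expect_sub_distrib, h1, expect_const univ_nonempty, sub_self]
  refine le_of_le_of_eq (b := 𝔼 x, -((if X x ∈ {x | g x < 0} then Real.exp (Λ x) else 0)
    - if X x ∈ {x | g x < 0} then 1 else 0) + 𝔼 x, (Real.exp (Λ x) - 1)) ?_ (by rw [h2, add_zero])
  rw [← expect_add_distrib]
  refine expect_le_expect fun x _ => ?_
  simp only [Set.mem_ofPred_eq]
  split_ifs with hx
  · rw [max_eq_right ((min_le_left _ _).trans hx.le), Real.exp_zero]
    have : 0 ≤ Real.exp c * |Λ x - g (X x)| := by positivity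
    linarith
  · rw [max_eq_left (le_min (not_lt.mp hx) hc)]
    have h := abs_exp_min_sub_exp_min_le (Λ x) (g (X x)) c
    have h3 := neg_abs_le (Real.exp (min (Λ x) c) - Real.exp (min (g (X x)) c))
    have h4 : Real.exp (min (Λ x) c) ≤ Real.exp (Λ x) := Real.exp_monotone (min_le_left _ _)
    linarith

end TotalVariation

section Gaussian

variable {v : NNReal}

theorem integral_exp_gaussianReal_neg_half :
    ∫ x, Real.exp x ∂(gaussianReal (-(v / 2)) v) = 1 := by
  have h := mgf_gaussianReal (μ := (-(v / 2 : ℝ))) (v := v)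
    (p := gaussianReal (-(v / 2)) v) (X := id) Measure.map_id 1
  simp only [mgf, id, one_mul] at h
  rw [h]
  simp

theorem integrable_exp_gaussianReal (μ : ℝ) :
    Integrable (fun x => Real.exp x) (gaussianReal μ v) := by
  simpa using integrable_exp_mul_gaussianReal (μ := μ) (v := v) 1

theorem integrable_exp_min_gaussianReal (μ c : ℝ) :
    Integrable (fun x => Real.exp (min x c)) (gaussianReal μ v) :=
  (integrable_exp_gaussianReal μ).mono' (by fun_prop)
    (ae_of_all _ fun x => by
      rw [Real.norm_eq_abs, Real.abs_exp]
      exact Real.exp_monotone (min_le_left _ _))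

theorem exp_min_add_exp_max (x : ℝ) :
    Real.exp (min x 0) + Real.exp (max x 0) = Real.exp x + 1 := by
  rcases le_total x 0 with h | h <;> simp [h, add_comm]

theorem integrable_exp_max_gaussianReal (μ : ℝ) :
    Integrable (fun x => Real.exp (max x 0)) (gaussianReal μ v) := by
  have : (fun x => Real.exp (max x 0)) = fun x => Real.exp x + 1 - Real.exp (min x 0) := by
    funext x
    linarith [exp_min_add_exp_max x]
  rw [this]
  exact ((integrable_exp_gaussianReal μ).add (integrable_const 1)).sub
    (integrable_exp_min_gaussianReal μ 0)

/-- The limit of the total variation distances: half of `E|1 - e^Z|` for a Gaussian `Z` with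
`E e^Z = 1` is `E(1 - e^Z)⁺`. -/
theorem half_integral_abs_one_sub_exp :
    (1 / 2 : ℝ) * ∫ x, |1 - Real.exp (-x)| ∂(gaussianReal (v / 2) v)
      = ∫ x, (1 - Real.exp (min x 0)) ∂(gaussianReal (-(v / 2)) v) := by
  have h1 : ∫ x, |1 - Real.exp (-x)| ∂(gaussianReal (v / 2) v)
      = ∫ x, |1 - Real.exp x| ∂(gaussianReal (-(v / 2)) v) := by
    rw [← gaussianReal_map_neg, integral_map (by fun_prop)
      (Continuous.aestronglyMeasurable (by fun_prop))]
  have h2 : ∀ x : ℝ, |1 - Real.exp x| = 2 * (1 - Real.exp (min x 0)) + (Real.exp x - 1) := by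
    intro x
    rcases le_total x 0 with h | h
    · rw [min_eq_left h, abs_of_nonneg (by simpa using h)]
      ring
    · rw [min_eq_right h, abs_of_nonpos (by simpa using h), Real.exp_zero]
      ring
  have h3 := integrable_exp_gaussianReal (v := v) (-(v / 2))
  have h4 := integrable_exp_min_gaussianReal (v := v) (-(v / 2)) 0
  have h5 : Integrable (fun x => 2 * (1 - Real.exp (min x 0))) (gaussianReal (-(v / 2)) v) :=
    ((integrable_const 1).sub h4).const_mul 2
  have h6 : Integrable (fun x => Real.exp x - 1) (gaussianReal (-(v / 2)) v) :=
    h3.sub (integrable_const 1)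
  rw [h1]
  simp only [h2]
  rw [integral_add h5 h6, integral_sub h3 (integrable_const 1), integral_exp_gaussianReal_neg_half,
    integral_const_mul]
  simp

/-- Positive and negative parts of `e^Z - 1` have equal means since `E e^Z = 1`; this matches the
forms of the lower and upper bounds. -/
theorem integral_exp_max_sub_one :
    ∫ x, (Real.exp (max x 0) - 1) ∂(gaussianReal (-(v / 2)) v)
      = ∫ x, (1 - Real.exp (min x 0)) ∂(gaussianReal (-(v / 2)) v) := by
  have h2 : ∀ x : ℝ, Real.exp (max x 0) - 1 = (1 - Real.exp (min x 0)) + (Real.exp x - 1) := by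
    intro x
    linarith [exp_min_add_exp_max x]
  have h3 := integrable_exp_gaussianReal (v := v) (-(v / 2))
  have h4 := integrable_exp_min_gaussianReal (v := v) (-(v / 2)) 0
  have h5 : Integrable (fun x => 1 - Real.exp (min x 0)) (gaussianReal (-(v / 2)) v) :=
    (integrable_const 1).sub h4
  have h6 : Integrable (fun x => Real.exp x - 1) (gaussianReal (-(v / 2)) v) :=
    h3.sub (integrable_const 1)
  simp only [h2]
  rw [integral_add h5 h6, integral_sub h3 (integrable_const 1), integral_exp_gaussianReal_neg_half]
  simp

theorem tendsto_integral_exp_max_min (μ : ℝ) :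
    Tendsto (fun c : ℕ => ∫ x, (Real.exp (max (min x c) 0) - 1) ∂(gaussianReal μ v)) atTop
      (𝓝 (∫ x, (Real.exp (max x 0) - 1) ∂(gaussianReal μ v))) := by
  refine tendsto_integral_of_dominated_convergence (fun x => Real.exp (max x 0))
    (fun c => Continuous.aestronglyMeasurable (by fun_prop)) (integrable_exp_max_gaussianReal μ)
    (fun c => ae_of_all _ fun x => ?_) (ae_of_all _ fun x => ?_)
  · have h1 : 1 ≤ Real.exp (max (min x c) 0) := Real.one_le_exp (le_max_right _ _)
    have h2 : Real.exp (max (min x c) 0) ≤ Real.exp (max x 0) :=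
      Real.exp_monotone (max_le_max_right _ (min_le_left _ _))
    rw [Real.norm_eq_abs, abs_of_nonneg (by linarith)]
    linarith
  · obtain ⟨N, hN⟩ := exists_nat_ge x
    refine tendsto_const_nhds.congr' ?_
    filter_upwards [eventually_ge_atTop N] with c hc
    rw [min_eq_left (hN.trans (by exact_mod_cast hc))]

end Gaussian

end KOut

end

/-! ### Weak convergence of the normalized statistic and conclusion. -/

noncomputable section

namespace KOut

open Finset MeasureTheory ProbabilityTheory Filter
open scoped BigOperators Topology

variable {n k : ℕ}

/-- The normalized number of collisions, the approximate logarithm of the likelihood ratio, as a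
function of the sum of the squared in-degrees. -/
def normalizedStat (n k : ℕ) (β : ℝ) (x : ℕ) : ℝ :=
  (((x : ℝ) - k * n) / 2 - (k * n : ℝ) * (k * n - 1) / (2 * n)) / (β * Real.sqrt n)
    - k ^ 2 / (4 * β ^ 2)

instance : Nonempty (KOutMap n k) := ⟨fun v _ => v⟩

theorem card_arcs : Fintype.card (Fin n × Fin k) = k * n := by
  simp [mul_comm]

theorem normalizedStat_sumSqInDegree (β : ℝ) (F : KOutMap n k) :
    normalizedStat n k β (sumSqInDegree F)
      = collisions (Function.uncurry F) / (β * Real.sqrt n) - k ^ 2 / (4 * β ^ 2) := by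
  have h : ∀ j, inDegree F j = fiberCard (Function.uncurry F) j := fun j => rfl
  have hsum := sum_fiberCard (Function.uncurry F)
  rw [card_arcs] at hsum
  have hsum' : ∑ j, (fiberCard (Function.uncurry F) j : ℝ) = k * n := by exact_mod_cast hsum
  rw [normalizedStat, collisions, card_arcs, sumChoose, sumSqInDegree]
  simp only [h, Nat.cast_choose_two, Nat.cast_sum, Nat.cast_pow, ← sum_div, mul_sub, mul_one,
    sum_sub_distrib, hsum', ← sq, Nat.cast_mul]

theorem expect_uncurry {E : Type*} [AddCommMonoid E] [Module ℚ≥0 E]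
    (f : (Fin n × Fin k → Fin n) → E) :
    𝔼 F : KOutMap n k, f (Function.uncurry F) = 𝔼 J, f J :=
  Fintype.expect_equiv (Equiv.curry (Fin n) (Fin k) (Fin n)).symm _ _ fun _ => rfl

theorem prefAttachLaw_eq_exp {α : ℝ} (hα : 0 < α) (hn : 0 < n) (F : KOutMap n k) :
    prefAttachLaw n k α F = ENNReal.ofReal
      (Real.exp (logRatio α (Function.uncurry F)) / Fintype.card (KOutMap n k)) := by
  have hn' : (n : ℝ) ≠ 0 := by positivity
  have hcard : (Fintype.card (KOutMap n k) : ℝ) = (n : ℝ) ^ (k * n) := by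
    simp [pow_mul]
  rw [prefAttachLaw_apply hα hn, exp_logRatio hα hn, hcard, card_arcs, completeWeight,
    mul_div_cancel_left₀ _ (by positivity)]
  rfl

theorem uniformLaw_apply (F : KOutMap n k) :
    uniformLaw n k F = ENNReal.ofReal (1 / Fintype.card (KOutMap n k)) := by
  rw [uniformLaw, PMF.uniformOfFintype_apply, one_div, ENNReal.ofReal_inv_of_pos (by positivity),
    ENNReal.ofReal_natCast]

/-- Law of the normalized number of collisions in the uniformly random mapping. -/
def normalizedLaw (n k : ℕ) (β : ℝ) : Measure ℝ :=
  (uniformLaw n k).toMeasure.map fun F => normalizedStat n k β (sumSqInDegree F)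

instance (β : ℝ) : IsProbabilityMeasure (normalizedLaw n k β) :=
  Measure.isProbabilityMeasure_map (Measurable.of_discrete).aemeasurable

theorem integral_normalizedLaw {E : Type*} [NormedAddCommGroup E] [NormedSpace ℝ E]
    [CompleteSpace E] [Module ℚ≥0 E] [SecondCountableTopology E] (β : ℝ) {f : ℝ → E}
    (hf : Continuous f) :
    ∫ x, f x ∂(normalizedLaw n k β)
      = 𝔼 F : KOutMap n k, f (normalizedStat n k β (sumSqInDegree F)) := by
  rw [normalizedLaw, integral_map (Measurable.of_discrete).aemeasurable
    hf.aestronglyMeasurable, PMF.integral_eq_sum]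
  simp only [uniformLaw_apply]
  rw [Finset.expect, smul_sum, card_univ]
  refine sum_congr rfl fun F _ => ?_
  rw [ENNReal.toReal_ofReal (by positivity), ← NNRat.cast_smul_eq_nnqsmul ℝ]
  simp

theorem charFun_normalizedLaw (β : ℝ) (t : ℝ) :
    charFun (normalizedLaw n k β) t = Complex.exp (-(t * (k ^ 2 / (4 * β ^ 2) : ℝ) * Complex.I))
      * collisionCharFun (Fin n × Fin k) n ((t / β) / Real.sqrt n) := by
  rw [charFun_apply_real, integral_normalizedLaw β (by fun_prop), collisionCharFun, mul_expect,
    ← expect_uncurry]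
  refine expect_congr rfl fun F _ => ?_
  rw [normalizedStat_sumSqInDegree, ← Complex.exp_add]
  congr 1
  push_cast
  ring

theorem tendsto_collisionCharFun (k : ℕ) (θ : ℝ) :
    Tendsto (fun n : ℕ => collisionCharFun (Fin n × Fin k) n (θ / Real.sqrt n)) atTop
      (𝓝 (Complex.exp (-(k ^ 2 * θ ^ 2 / 4 : ℝ)))) := by
  have h1 : Tendsto (fun n : ℕ => collisionCharFun (Fin n × Fin k) n (θ / Real.sqrt n)
      * Complex.exp ((k ^ 2 * θ ^ 2 / 4 : ℝ) : ℂ)) atTop (𝓝 1) := by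
    rw [tendsto_iff_norm_sub_tendsto_zero]
    refine squeeze_zero' (Eventually.of_forall fun n => norm_nonneg _) ?_
      (Tendsto.const_div_atTop (Real.tendsto_sqrt_atTop.comp tendsto_natCast_atTop_atTop)
        (k / 2 * steinConst k * (|θ| + θ ^ 2) * Real.exp (k ^ 2 * θ ^ 2 / 4) * |θ|))
    filter_upwards [eventually_gt_atTop 0] with n hn
    exact norm_collisionCharFun_mul_exp_sub_one_le hn card_arcs θ
  have h2 := h1.mul_const (Complex.exp (-(k ^ 2 * θ ^ 2 / 4 : ℝ)))
  simp only [mul_assoc, ← Complex.exp_add, add_neg_cancel, Complex.exp_zero, mul_one,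
    one_mul] at h2
  exact h2

/-- Lévy's continuity theorem, applied with `θ = t / β`. -/
theorem tendsto_expect_normalizedStat (k : ℕ) {β : ℝ} (hβ : 0 < β) {f : ℝ → ℝ}
    (hf : Continuous f) {C : ℝ} (hC : ∀ x, ‖f x‖ ≤ C) :
    Tendsto (fun n : ℕ => 𝔼 F : KOutMap n k, f (normalizedStat n k β (sumSqInDegree F))) atTop
      (𝓝 (∫ x, f x ∂(gaussianReal (-(k ^ 2 / (4 * β ^ 2)))
        (Real.toNNReal (k ^ 2 / (2 * β ^ 2)))))) := by
  set ν : ProbabilityMeasure ℝ := ⟨gaussianReal (-(k ^ 2 / (4 * β ^ 2)))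
    (Real.toNNReal (k ^ 2 / (2 * β ^ 2))), inferInstance⟩ with hν
  set μ : ℕ → ProbabilityMeasure ℝ := fun n => ⟨normalizedLaw n k β, inferInstance⟩ with hμ
  have h : Tendsto μ atTop (𝓝 ν) := by
    refine ProbabilityMeasure.tendsto_of_tendsto_charFun fun t => ?_
    have h1 := (tendsto_collisionCharFun k (t / β)).const_mul
      (Complex.exp (-(t * (k ^ 2 / (4 * β ^ 2) : ℝ) * Complex.I)))
    simp only [← charFun_normalizedLaw] at h1
    refine h1.trans_eq ?_
    rw [hν]
    simp only [ProbabilityMeasure.coe_mk]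
    rw [charFun_gaussianReal, ← Complex.exp_add, Real.coe_toNNReal _ (by positivity)]
    congr 2
    push_cast
    have : (β : ℂ) ≠ 0 := by exact_mod_cast hβ.ne'
    field_simp
    ring
  have h2 := ProbabilityMeasure.tendsto_iff_forall_integral_tendsto.mp h
    (BoundedContinuousFunction.ofNormedAddCommGroup f hf C hC)
  refine h2.congr fun n => ?_
  exact integral_normalizedLaw β hf

end KOut

end

theorem theorem2 (k : ℕ) (hk : 1 ≤ k) (β : ℝ) (hβ : 0 < β) :
    Filter.Tendsto
      (fun n : ℕ =>
        KOut.tvDist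
          ((KOut.prefAttachLaw n k (β * Real.sqrt n)).map KOut.sumSqInDegree)
          ((KOut.uniformLaw n k).map KOut.sumSqInDegree))
      Filter.atTop
      (nhds ((1 / 2 : ℝ) *
        ∫ x : ℝ, |1 - Real.exp (-x)|
          ∂(ProbabilityTheory.gaussianReal ((k : ℝ) ^ 2 / (4 * β ^ 2))
            (Real.toNNReal ((k : ℝ) ^ 2 / (2 * β ^ 2)))))) := by
  open KOut Finset MeasureTheory ProbabilityTheory Filter BigOperators Topology in
  set v := Real.toNNReal ((k : ℝ) ^ 2 / (2 * β ^ 2)) with hv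
  -- The mean is half the variance, which is what gives `E e^(-𝒩) = 1`.
  have hvm : (k : ℝ) ^ 2 / (4 * β ^ 2) = v / 2 := by
    rw [hv, Real.coe_toNNReal _ (by positivity)]
    ring
  have hδ : Tendsto (fun n : ℕ => likelihoodConst k β / Real.sqrt n) atTop (𝓝 0) :=
    Tendsto.const_div_atTop (Real.tendsto_sqrt_atTop.comp tendsto_natCast_atTop_atTop) _
  have hlim : ∀ {f : ℝ → ℝ} {C : ℝ}, Continuous f → (∀ x, ‖f x‖ ≤ C) →
      Tendsto (fun n : ℕ => 𝔼 F : KOutMap n k, f (normalizedStat n k β (sumSqInDegree F))) atTop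
        (𝓝 (∫ x, f x ∂(gaussianReal (-(v / 2)) v))) := by
    intro f C hf hC
    rw [← hvm]
    exact tendsto_expect_normalizedStat k hβ hf hC
  have herr : ∀ n : ℕ, 0 < n → 𝔼 F : KOutMap n k, |logRatio (β * Real.sqrt n)
      (Function.uncurry F) - normalizedStat n k β (sumSqInDegree F)|
      ≤ likelihoodConst k β / Real.sqrt n := by
    intro n hn
    simp only [normalizedStat_sumSqInDegree]
    rw [expect_uncurry (fun J : Fin n × Fin k → Fin n => |logRatio (β * Real.sqrt n) J
      - (collisions J / (β * Real.sqrt n) - k ^ 2 / (4 * β ^ 2))|)]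
    exact expect_abs_logRatio_sub_le hn card_arcs hβ
  have hα : ∀ n : ℕ, 0 < n → 0 < β * Real.sqrt n := fun n hn =>
    mul_pos hβ (Real.sqrt_pos.mpr (by exact_mod_cast hn))
  rw [hvm, half_integral_abs_one_sub_exp, tendsto_order]
  constructor
  · intro a ha
    rw [← integral_exp_max_sub_one] at ha
    -- The truncation level is fixed before `n` tends to infinity, so the error factor `e^c` stays
    -- constant.
    obtain ⟨c, hc⟩ := ((tendsto_order.mp (tendsto_integral_exp_max_min (v := v) _)).1 a ha).exists
    have h1 := (hlim (f := fun x => Real.exp (max (min x c) 0) - 1) (C := Real.exp c)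
      (by fun_prop) (fun x => by
        have h1 : 1 ≤ Real.exp (max (min x c) 0) := Real.one_le_exp (le_max_right _ _)
        have h2 : Real.exp (max (min x c) 0) ≤ Real.exp c :=
          Real.exp_monotone (max_le (min_le_right _ _) (by positivity))
        rw [Real.norm_eq_abs, abs_of_nonneg (by linarith)]
        linarith)).sub (hδ.const_mul (Real.exp c))
    rw [mul_zero, sub_zero] at h1
    filter_upwards [(tendsto_order.mp h1).1 a hc, eventually_gt_atTop 0] with n hn hn0
    have h2 := le_tvDist_map (fun F => prefAttachLaw_eq_exp (hα n hn0) hn0 F)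
      (fun F => uniformLaw_apply (n := n) (k := k) F) sumSqInDegree (normalizedStat n k β)
      (c := c) (by positivity)
    have h3 := mul_le_mul_of_nonneg_left (herr n hn0) (Real.exp_pos c).le
    linarith
  · intro a ha
    -- This integrand is already bounded, so no truncation level is needed.
    have h1 := (hlim (f := fun x => 1 - Real.exp (min x 0)) (C := 1)
      (by fun_prop) (fun x => by
        have h1 : Real.exp (min x 0) ≤ 1 := Real.exp_le_one_iff.mpr (min_le_right _ _)
        have h2 := Real.exp_pos (min x 0)
        rw [Real.norm_eq_abs, abs_of_nonneg (by linarith)]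
        linarith)).add hδ
    rw [add_zero] at h1
    filter_upwards [(tendsto_order.mp h1).2 a ha, eventually_gt_atTop 0] with n hn hn0
    have h2 := tvDist_map_le (fun F => prefAttachLaw_eq_exp (hα n hn0) hn0 F)
      (fun F => uniformLaw_apply (n := n) (k := k) F) sumSqInDegree
      (fun F => normalizedStat n k β (sumSqInDegree F))
    have h3 := herr n hn0
    linarith
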